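/- Let $d\in\mathbb N$ and let $\mathcal G=(G_n)$ be a sequence of nonempty finite simple graphs with vertex degrees at most $d$. Write $B_r^{G}(x)$ for the subgraph of $G$ induced on $\{y : d_G(x,y)\le r\}$, rooted at $x$, where $d_G$ is the path metric ($d_G=\infty$ between different components). Assume: (a) $\mathcal G$ is weakly (Benjamini--Schramm) convergent: for all $r\in\mathbb N$ and every finite rooted graph $\alpha$, the limit of $|\{x\in V(G_n): B_r^{G_n}(x)\cong\alpha\}|/|V(G_n)|$ as $n\to\infty$ exists ($\cong$ is rooted isomorphism). (b) $\mathcal G$ is hyperfinite: for every $\varepsilon>0$ there is $K\in\mathbb N$ such that from each $G_n$ one can delete at most $\varepsilon|E(G_n)|$ edges so that all components of the remaining graph have at most $K$ vertices. (c) $\mathcal H=(H_n)$ is a convergent sequence of finite-range, pattern-invariant self-adjoint operators: there are $R\in\mathbb N$ and functions $h_n:V(G_n)\times V(G_n)\to\mathbb R$ such that $h_n(x,y)=h_n(y,x)$; $h_n(x,y)=0$ if $d_{G_n}(x,y)>R$; for all $m,n$, $x\in V(G_m)$, $x'\in V(G_n)$ and every rooted isomorphism $\varphi:B_R^{G_m}(x)\to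 B_R^{G_n}(x')$ one has $h_m(x,y)=h_n(x',\varphi(y))$ for all $y\in B_R^{G_m}(x)$; and $(H_nu)(x)=\sum_y h_n(x,y)u(y)$ on $\ell^2(V(G_n))$. Let $N_{H_n}(\lambda)$ be the number of eigenvalues of $H_n$ in $(-\infty,\lambda]$, counted with multiplicity, divided by $|V(G_n)|$. Let $\mathcal O_{\mathcal G}$ be the $*$-algebra of all sequences $A=(A_n)$ of complex matrices on $V(G_n)$ whose entries satisfy, for some $R=R(A)$, the finite range and the pattern invariance conditions of (c) (symmetry is not required), with operations taken for each $n$. For $A\in\mathcal O_{\mathcal G}$ the limit $\operatorname{tr}_{\mathcal G}(A)=\lim_n |V(G_n)|^{-1}\operatorname{Tr}(A_n)$ exists. The Hilbert space $\mathcal K$ is the separated completion of $\mathcal O_{\mathcal G}$ for the positive semidefinite inner product $\langle A,B\rangle=\operatorname{tr}_{\mathcal G}(A^*B)$. Left multiplication by $A\in\mathcal O_{\mathcal G}$ induces a bounded operator $[A]$ on $\mathcal K$. Let $\mathcal M$ be the von Neumann algebra generated by all $[A]$, with trace $\operatorname{tr}_{\mathcal G}(T)=\langle \mathbf 1,T\mathbf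 1\rangle$, where $\mathbf 1\in\mathcal K$ is the class of the sequence of identity matrices. The operator $[\mathcal H]$ is bounded and self-adjoint and its spectral projections $\mathbf 1_{(-\infty,\lambda]}([\mathcal H])$ lie in $\mathcal M$. The integrated density of states is $N_{[\mathcal H]}(\lambda)=\operatorname{tr}_{\mathcal G}\big(\mathbf 1_{(-\infty,\lambda]}([\mathcal H])\big)$. Then $N_{H_n}$ converges uniformly to $N_{[\mathcal H]}$: $$\lim_{n\to\infty}\ \sup_{\lambda\in\mathbb R}\big|N_{H_n}(\lambda)-N_{[\mathcal H]}(\lambda)\big|=0 .$$ -/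

import Mathlib

universe u

namespace GraphLimit

/-- The closed `r`-ball around `x` in the path metric (`edist` is `⊤` between different components). -/
def ball {V : Type*} (G : SimpleGraph V) (r : ℕ) (x : V) : Set V := {y | G.edist x y ≤ r}

theorem self_mem_ball {V : Type*} (G : SimpleGraph V) (r : ℕ) (x : V) : x ∈ ball G r x := by
  simp [ball]

/-- The subgraph of `G` induced on the closed `r`-ball around `x`. -/
abbrev ballGraph {V : Type*} (G : SimpleGraph V) (r : ℕ) (x : V) : SimpleGraph (ball G r x) :=
  G.induce (ball G r x)

/-- The centre of a ball, as root of `ballGraph G r x`. -/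
def ballRoot {V : Type*} (G : SimpleGraph V) (r : ℕ) (x : V) : ball G r x :=
  ⟨x, self_mem_ball G r x⟩

/-- `(G, x)` and `(G', x')` are rooted isomorphic. -/
def RootedIso {V W : Type*} (G : SimpleGraph V) (x : V) (G' : SimpleGraph W) (x' : W) : Prop :=
  ∃ φ : G ≃g G', φ x = x'

/-- A finite rooted graph on a standard vertex set. Every rooted isomorphism class of finite graphs
has such a representative. -/
structure RootedGraph where
  size : ℕ
  graph : SimpleGraph (Fin size)
  root : Fin size

/-- The proportion of the vertices of the finite graph `G` whose `r`-ball is rooted isomorphic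
to `α`. -/
noncomputable def freq {V : Type*} [Fintype V] (G : SimpleGraph V) (r : ℕ) (α : RootedGraph) : ℝ :=
  ({x : V | RootedIso (ballGraph G r x) (ballRoot G r x) α.graph α.root}.ncard : ℝ) /
    (Fintype.card V : ℝ)

/-- A sequence of nonempty finite simple graphs with vertex degrees bounded by `d`. -/
structure GraphSeq (d : ℕ) where
  V : ℕ → Type u
  fintypeV : ∀ n, Fintype (V n)
  nonemptyV : ∀ n, Nonempty (V n)
  graph : ∀ n, SimpleGraph (V n)
  degree_le : ∀ n x, ((graph n).neighborSet x).ncard ≤ d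

attribute [instance] GraphSeq.fintypeV GraphSeq.nonemptyV

noncomputable instance {d : ℕ} (G : GraphSeq.{u} d) (n : ℕ) : DecidableEq (G.V n) :=
  Classical.decEq _

/-- Weak (Benjamini-Schramm) convergence: the frequency of each pattern of each radius converges. -/
def GraphSeq.WeaklyConvergent {d : ℕ} (G : GraphSeq.{u} d) : Prop :=
  ∀ (r : ℕ) (α : RootedGraph), ∃ p : ℝ,
    Filter.Tendsto (fun n => freq (G.graph n) r α) Filter.atTop (nhds p)

/-- Hyperfiniteness: for each `ε > 0` there is `K` such that from each graph of the sequence one can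
delete a set `S` of at most `ε |E|` edges so that the components that remain have at most `K`
vertices. -/
def GraphSeq.Hyperfinite {d : ℕ} (G : GraphSeq.{u} d) : Prop :=
  ∀ ε : ℝ, 0 < ε → ∃ K : ℕ, ∀ n, ∃ S : Set (Sym2 (G.V n)), S ⊆ (G.graph n).edgeSet ∧
    (S.ncard : ℝ) ≤ ε * ((G.graph n).edgeSet.ncard : ℝ) ∧
    ∀ c : ((G.graph n).deleteEdges S).ConnectedComponent, c.supp.ncard ≤ K

/-- Finite hopping range `R` of a sequence of kernels `h n : V n × V n → K`. -/
def FiniteRange {d : ℕ} (G : GraphSeq.{u} d) {K : Type*} [Zero K] (R : ℕ)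
    (h : ∀ n, G.V n → G.V n → K) : Prop :=
  ∀ n x y, y ∉ ball (G.graph n) R x → h n x y = 0

/-- Pattern invariance with radius `R`, uniformly along the sequence: the row `h n x` on the
`R`-ball of `x` is determined by the rooted isomorphism class of that ball. More precisely, each
rooted isomorphism of `R`-balls, be it within one graph or between two graphs of the sequence,
carries one row to the other. Equivalently, there is for each class `α` of rooted `R`-balls a
function `h_α : V(α) → K`, the same for all `n`, with `h n x y = h_α (φ y)` for each rooted
isomorphism `φ` from the `R`-ball of `x` onto `α`. -/
def PatternInvariant {d : ℕ} (G : GraphSeq.{u} d) {K : Type*} (R : ℕ)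
    (h : ∀ n, G.V n → G.V n → K) : Prop :=
  ∀ (m n : ℕ) (x : G.V m) (x' : G.V n)
    (φ : ballGraph (G.graph m) R x ≃g ballGraph (G.graph n) R x'),
    φ (ballRoot (G.graph m) R x) = ballRoot (G.graph n) R x' →
      ∀ y : ball (G.graph m) R x, h m x y = h n x' (φ y)

/-- A convergent operator sequence on `G`: real symmetric kernels of a common finite range `R` that
are pattern invariant with one and the same family `h_α`. -/
structure OperatorSeq {d : ℕ} (G : GraphSeq.{u} d) where
  range : ℕ
  kernel : ∀ n, G.V n → G.V n → ℝ
  symm : ∀ n x y, kernel n x y = kernel n y x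
  finiteRange : FiniteRange G range kernel
  patternInvariant : PatternInvariant G range kernel

/-- The operator `H_n`, as a real matrix: `(H_n u)(x) = ∑ y, h_n(x, y) u(y)`, where only the `y` in
the `R`-ball of `x` contribute. -/
def OperatorSeq.matrix {d : ℕ} {G : GraphSeq.{u} d} (H : OperatorSeq G) (n : ℕ) :
    Matrix (G.V n) (G.V n) ℝ :=
  Matrix.of (H.kernel n)

theorem OperatorSeq.isHermitian {d : ℕ} {G : GraphSeq.{u} d} (H : OperatorSeq G) (n : ℕ) :
    (H.matrix n).IsHermitian := by
  ext x y
  simp [OperatorSeq.matrix, H.symm n x y]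

/-- The normalized eigenvalue counting function of `H_n`: the number of the eigenvalues `≤ t`,
counted with multiplicity, divided by `|V(G_n)|`. -/
noncomputable def OperatorSeq.counting {d : ℕ} {G : GraphSeq.{u} d} (H : OperatorSeq G) (n : ℕ)
    (t : ℝ) : ℝ :=
  ({i : G.V n | (H.isHermitian n).eigenvalues i ≤ t}.ncard : ℝ) / (Fintype.card (G.V n) : ℝ)

/-! ### Balls and their isomorphisms -/

section Balls

variable {V W : Type*} {G : SimpleGraph V} {G' : SimpleGraph W}

theorem mem_ball_comm {r : ℕ} {x y : V} : y ∈ ball G r x ↔ x ∈ ball G r y := by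
  simp only [ball, Set.mem_ofPred_eq, G.edist_comm (u := x)]

theorem mem_ball_trans {r s t : ℕ} {x y z : V} (hy : y ∈ ball G r x) (hz : z ∈ ball G s y)
    (h : r + s ≤ t) : z ∈ ball G t x := by
  simp only [ball, Set.mem_ofPred_eq] at *
  calc G.edist x z ≤ G.edist x y + G.edist y z := G.edist_triangle
    _ ≤ (r : ℕ∞) + s := add_le_add hy hz
    _ ≤ t := by exact_mod_cast h

theorem mem_ball_zero {x y : V} : y ∈ ball G 0 x ↔ y = x := by
  simp [ball, eq_comm (a := y)]

theorem mem_ball_succ {r : ℕ} {x y : V} (h : y ∈ ball G (r + 1) x) :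
    ∃ w ∈ ball G r x, w = y ∨ G.Adj w y := by
  rw [mem_ball_comm] at h
  have hne : G.edist y x ≠ ⊤ := ne_top_of_le_ne_top (ENat.natCast_ne_top _) h
  obtain ⟨p, hp⟩ := G.exists_walk_of_edist_ne_top hne
  cases p with
  | nil => exact ⟨x, self_mem_ball G r x, Or.inl rfl⟩
  | cons hadj q =>
    rename_i w
    refine ⟨w, ?_, Or.inr hadj.symm⟩
    rw [mem_ball_comm]
    have h1 : G.edist w x ≤ q.length := G.edist_le q
    simp only [ball, Set.mem_ofPred_eq] at h ⊢
    rw [← hp] at h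
    simp only [SimpleGraph.Walk.length_cons] at h
    have h2 : q.length + 1 ≤ r + 1 := by exact_mod_cast h
    refine h1.trans ?_
    exact_mod_cast (by omega : q.length ≤ r)

theorem mem_ball_succ_of {r : ℕ} {x w y : V} (hw : w ∈ ball G r x) (h : w = y ∨ G.Adj w y) :
    y ∈ ball G (r + 1) x := by
  refine mem_ball_trans (s := 1) hw ?_ le_rfl
  rcases h with rfl | h
  · exact self_mem_ball G 1 w
  · simp only [ball, Set.mem_ofPred_eq]
    exact_mod_cast (SimpleGraph.edist_eq_one_iff_adj.2 h).le

theorem map_mem_ball {T : ℕ} {x : V} {x' : W} (φ : ballGraph G T x ≃g ballGraph G' T x')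
    {r : ℕ} (z : ball G T x) (hz : (z : V) ∈ ball G r x) (s : ℕ) (hT : r + s ≤ T)
    (y : ball G T x) (hy : (y : V) ∈ ball G s z) : (φ y : W) ∈ ball G' s (φ z) := by
  induction s generalizing y with
  | zero =>
    have : y = z := Subtype.ext (mem_ball_zero.1 hy)
    rw [this]
    exact self_mem_ball _ _ _
  | succ s ih =>
    obtain ⟨w, hw, h⟩ := mem_ball_succ hy
    have hwT : w ∈ ball G T x := mem_ball_trans hz hw (by omega)
    refine mem_ball_succ_of (ih (by omega) ⟨w, hwT⟩ hw) ?_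
    rcases h with h | h
    · left
      congr 2
      exact Subtype.ext h
    · right
      have : (ballGraph G T x).Adj ⟨w, hwT⟩ y := h
      exact φ.map_rel_iff.2 this

theorem map_mem_ball_iff {T : ℕ} {x : V} {x' : W} (φ : ballGraph G T x ≃g ballGraph G' T x')
    (hφ : φ (ballRoot G T x) = ballRoot G' T x')
    {r : ℕ} (z : ball G T x) (hz : (z : V) ∈ ball G r x) (s : ℕ) (hT : r + s ≤ T)
    (y : ball G T x) : (φ y : W) ∈ ball G' s (φ z) ↔ (y : V) ∈ ball G s z := by
  refine ⟨fun h => ?_, map_mem_ball φ z hz s hT y⟩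
  have hz' : (φ z : W) ∈ ball G' r x' := by
    have := map_mem_ball φ (r := 0) (ballRoot G T x) (self_mem_ball _ _ _) r (by omega) z hz
    rw [hφ] at this
    exact this
  have := map_mem_ball φ.symm (φ z) hz' s hT (φ y) h
  simpa using this

/-- A rooted isomorphism of balls restricts to the smaller balls around the interior points. -/
theorem exists_restrict {T : ℕ} {x : V} {x' : W} (φ : ballGraph G T x ≃g ballGraph G' T x')
    (hφ : φ (ballRoot G T x) = ballRoot G' T x')
    {r : ℕ} (z : ball G T x) (hz : (z : V) ∈ ball G r x) (s : ℕ) (hT : r + s ≤ T) :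
    ∃ ψ : ballGraph G s z ≃g ballGraph G' s (φ z),
      ψ (ballRoot G s z) = ballRoot G' s (φ z) ∧
      ∀ (y : ball G s z) (hy : (y : V) ∈ ball G T x), (ψ y : W) = φ ⟨y, hy⟩ := by
  have hsub : ∀ y ∈ ball G s (z : V), y ∈ ball G T x := fun y hy => mem_ball_trans hz hy hT
  have hz' : (φ z : W) ∈ ball G' r x' := by
    have := map_mem_ball φ (r := 0) (ballRoot G T x) (self_mem_ball _ _ _) r (by omega) z hz
    rw [hφ] at this
    exact this
  have hsub' : ∀ y ∈ ball G' s (φ z : W), y ∈ ball G' T x' :=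
    fun y hy => mem_ball_trans hz' hy hT
  let e : ball G s (z : V) ≃ ball G' s (φ z : W) :=
    { toFun := fun y => ⟨φ ⟨y, hsub y y.2⟩, (map_mem_ball_iff φ hφ z hz s hT _).2 y.2⟩
      invFun := fun y => ⟨φ.symm ⟨y, hsub' y y.2⟩, by
        rw [← map_mem_ball_iff φ hφ z hz s hT]
        simp⟩
      left_inv := fun y => by simp
      right_inv := fun y => by simp }
  refine ⟨⟨e, ?_⟩, ?_, fun y hy => rfl⟩
  · intro a b
    have := φ.map_rel_iff (a := ⟨a, hsub a a.2⟩) (b := ⟨b, hsub b b.2⟩)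
    exact this
  · rfl

theorem RootedIso.symm {x : V} {x' : W} (h : RootedIso G x G' x') : RootedIso G' x' G x := by
  obtain ⟨φ, rfl⟩ := h
  exact ⟨φ.symm, by simp⟩

theorem RootedIso.trans {U : Type*} {G'' : SimpleGraph U} {x : V} {x' : W} {x'' : U}
    (h : RootedIso G x G' x') (h' : RootedIso G' x' G'' x'') : RootedIso G x G'' x'' := by
  obtain ⟨φ, rfl⟩ := h
  obtain ⟨ψ, rfl⟩ := h'
  exact ⟨φ.trans ψ, rfl⟩

theorem RootedIso.refl {x : V} : RootedIso G x G x := ⟨SimpleGraph.Iso.refl, rfl⟩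

theorem ncard_ball_le [Finite V] {d : ℕ} (hd : ∀ x, (G.neighborSet x).ncard ≤ d) (r : ℕ) (x : V) :
    (ball G r x).ncard ≤ (d + 1) ^ r := by
  induction r with
  | zero =>
    have : ball G 0 x = {x} := by
      ext y
      simp [mem_ball_zero]
    simp [this]
  | succ r ih =>
    classical
    have := Fintype.ofFinite V
    have hsub : ball G (r + 1) x ⊆
        ((ball G r x).toFinset.biUnion fun w => (insert w (G.neighborSet w)).toFinset : Finset V) := by
      intro y hy
      obtain ⟨w, hw, h⟩ := mem_ball_succ hy
      simp only [Finset.coe_biUnion, Set.mem_iUnion]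
      refine ⟨w, by simpa using hw, ?_⟩
      rcases h with rfl | h
      · simp
      · simp [h]
    calc (ball G (r + 1) x).ncard ≤ _ := Set.ncard_le_ncard hsub
      _ = _ := Set.ncard_coe_finset _
      _ ≤ (ball G r x).toFinset.card * (d + 1) := by
        refine Finset.card_biUnion_le_card_mul _ _ _ fun w _ => ?_
        rw [← Set.ncard_eq_toFinset_card']
        exact (Set.ncard_insert_le _ _).trans (Nat.add_le_add_right (hd w) 1)
      _ ≤ (d + 1) ^ r * (d + 1) := by
        rw [← Set.ncard_eq_toFinset_card']
        exact Nat.mul_le_mul_right _ ih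
      _ = _ := (pow_succ _ _).symm

end Balls

/-! ### Averages of local functions -/

section Averages

variable {d : ℕ}

/-- A function of the vertices that depends only on the class of the `R`-ball. -/
def IsLocal (G : GraphSeq.{u} d) {K : Type*} (R : ℕ) (f : ∀ n, G.V n → K) : Prop :=
  ∀ m n x x', RootedIso (ballGraph (G.graph m) R x) (ballRoot (G.graph m) R x)
    (ballGraph (G.graph n) R x') (ballRoot (G.graph n) R x') → f m x = f n x'

/-- Finitely many pairwise non-isomorphic rooted graphs represent all `R`-balls of the sequence. -/
theorem exists_patterns (G : GraphSeq.{u} d) (R : ℕ) :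
    ∃ s : Finset RootedGraph, ∀ n (x : G.V n), ∃! α, α ∈ s ∧
      RootedIso (ballGraph (G.graph n) R x) (ballRoot (G.graph n) R x) α.graph α.root := by
  classical
  let S : Setoid RootedGraph :=
    ⟨fun α β => RootedIso α.graph α.root β.graph β.root,
      fun _ => RootedIso.refl, RootedIso.symm, RootedIso.trans⟩
  let T : Set RootedGraph := {α | α.size ≤ (d + 1) ^ R}
  have hT : T.Finite := by
    let f : (Σ k : Fin ((d + 1) ^ R + 1), SimpleGraph (Fin k) × Fin k) → RootedGraph :=
      fun a => ⟨a.1, a.2.1, a.2.2⟩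
    refine (Set.finite_range f).subset ?_
    rintro ⟨k, g, v⟩ hk
    exact ⟨⟨⟨k, Nat.lt_succ_of_le hk⟩, g, v⟩, rfl⟩
  refine ⟨hT.toFinset.image fun α => (Quotient.mk S α).out, fun n x => ?_⟩
  have hcard : (ball (G.graph n) R x).ncard ≤ (d + 1) ^ R := ncard_ball_le (G.degree_le n) R x
  let e : ball (G.graph n) R x ≃ Fin (ball (G.graph n) R x).ncard :=
    Finite.equivFinOfCardEq (Nat.card_coe_set_eq _)
  let β : RootedGraph := ⟨_, (ballGraph (G.graph n) R x).map e.toEmbedding,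
    e (ballRoot (G.graph n) R x)⟩
  have hβ : RootedIso (ballGraph (G.graph n) R x) (ballRoot (G.graph n) R x) β.graph β.root :=
    ⟨SimpleGraph.Iso.map e _, rfl⟩
  have hout : ∀ α : RootedGraph,
      RootedIso (Quotient.mk S α).out.graph (Quotient.mk S α).out.root α.graph α.root :=
    fun α => Quotient.exact (s := S) (Quotient.out_eq (Quotient.mk S α))
  refine ⟨(Quotient.mk S β).out, ⟨?_, hβ.trans (hout β).symm⟩, ?_⟩
  · exact Finset.mem_image.2 ⟨β, by simpa [T, β] using hcard, rfl⟩
  · rintro γ ⟨hγ, hγ'⟩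
    obtain ⟨δ, -, rfl⟩ := Finset.mem_image.1 hγ
    congr 1
    exact Quotient.sound (s := S) ((hout δ).symm.trans (hγ'.symm.trans hβ))

/-- The average of a local function is a finite combination of pattern frequencies. -/
theorem average_eq {G : GraphSeq.{u} d} {R : ℕ} {f : ∀ n, G.V n → ℂ} (hf : IsLocal G R f) :
    ∃ (s : Finset RootedGraph) (c : RootedGraph → ℂ),
      (∀ n x, ∃ α ∈ s, f n x = c α) ∧
      ∀ n, (∑ x, f n x) / (Fintype.card (G.V n) : ℂ) =
        ∑ α ∈ s, (freq (G.graph n) R α : ℂ) * c α := by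
  classical
  obtain ⟨s, hs⟩ := exists_patterns G R
  let c : RootedGraph → ℂ := fun α =>
    if h : ∃ a : Σ n, G.V n, RootedIso (ballGraph (G.graph a.1) R a.2)
      (ballRoot (G.graph a.1) R a.2) α.graph α.root then f h.choose.1 h.choose.2 else 0
  have hc : ∀ n x α, RootedIso (ballGraph (G.graph n) R x) (ballRoot (G.graph n) R x)
      α.graph α.root → f n x = c α := by
    intro n x α h
    have h' : ∃ a : Σ n, G.V n, RootedIso (ballGraph (G.graph a.1) R a.2)
      (ballRoot (G.graph a.1) R a.2) α.graph α.root := ⟨⟨n, x⟩, h⟩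
    simp only [c, dif_pos h']
    exact hf _ _ _ _ (h.trans h'.choose_spec.symm)
  refine ⟨s, c, fun n x => ?_, fun n => ?_⟩
  · obtain ⟨α, ⟨hα, hα'⟩, -⟩ := hs n x
    exact ⟨α, hα, hc n x α hα'⟩
  · have h1 : ∀ x, f n x = ∑ α ∈ s, if RootedIso (ballGraph (G.graph n) R x)
        (ballRoot (G.graph n) R x) α.graph α.root then c α else 0 := by
      intro x
      obtain ⟨α, ⟨hα, hα'⟩, huniq⟩ := hs n x
      rw [Finset.sum_eq_single α]
      · rw [if_pos hα', hc n x α hα']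
      · intro β hβ hne
        rw [if_neg]
        exact fun h => hne (huniq β ⟨hβ, h⟩)
      · exact fun h => absurd hα h
    simp_rw [h1]
    rw [Finset.sum_comm, Finset.sum_div]
    refine Finset.sum_congr rfl fun α _ => ?_
    rw [← Finset.sum_filter, Finset.sum_const, nsmul_eq_mul, freq]
    have : {x | RootedIso (ballGraph (G.graph n) R x) (ballRoot (G.graph n) R x)
        α.graph α.root}.ncard = (Finset.univ.filter fun x => RootedIso (ballGraph (G.graph n) R x)
        (ballRoot (G.graph n) R x) α.graph α.root).card := by
      rw [← Set.ncard_coe_finset]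
      congr 1
      ext x
      simp
    rw [this]
    push_cast
    ring

theorem IsLocal.tendsto {G : GraphSeq.{u} d} (hG : G.WeaklyConvergent) {R : ℕ}
    {f : ∀ n, G.V n → ℂ} (hf : IsLocal G R f) :
    ∃ l : ℂ, Filter.Tendsto (fun n => (∑ x, f n x) / (Fintype.card (G.V n) : ℂ))
      Filter.atTop (nhds l) := by
  obtain ⟨s, c, -, h⟩ := average_eq hf
  choose p hp using hG R
  refine ⟨∑ α ∈ s, (p α : ℂ) * c α, ?_⟩
  simp_rw [h]
  refine tendsto_finsetSum _ fun α _ => Filter.Tendsto.mul_const _ ?_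
  exact (Complex.continuous_ofReal.tendsto _).comp (hp α)

theorem IsLocal.bounded {G : GraphSeq.{u} d} {R : ℕ} {f : ∀ n, G.V n → ℂ} (hf : IsLocal G R f) :
    ∃ C : ℝ, 0 ≤ C ∧ ∀ n x, ‖f n x‖ ≤ C := by
  obtain ⟨s, c, h, -⟩ := average_eq hf
  refine ⟨∑ α ∈ s, ‖c α‖, Finset.sum_nonneg fun _ _ => norm_nonneg _, fun n x => ?_⟩
  obtain ⟨α, hα, hx⟩ := h n x
  rw [hx]
  exact Finset.single_le_sum (f := fun α => ‖c α‖) (fun _ _ => norm_nonneg _) hα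

end Averages

/-! ### The algebra of finite range, pattern invariant kernels -/

section Algebra

variable {d : ℕ} {G : GraphSeq.{u} d}

theorem sum_eq_sum_subtype {V : Type*} [Fintype V] (s : Set V) [Fintype s] (f : V → ℂ)
    (hf : ∀ z, z ∉ s → f z = 0) : ∑ z, f z = ∑ z : s, f z := by
  classical
  rw [← Finset.sum_subtype (Finset.univ.filter fun z => z ∈ s) (by simp) f]
  symm
  refine Finset.sum_filter_of_ne fun z _ hz => ?_
  by_contra h
  exact hz (hf z h)

/-- Rows of a kernel at interior points of a ball are carried along by isomorphisms of that ball. -/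
theorem PatternInvariant.apply_eq {K : Type*} [Zero K] {R : ℕ} {h : ∀ n, G.V n → G.V n → K}
    (hr : FiniteRange G R h) (hp : PatternInvariant G R h) {m n T : ℕ} {x : G.V m} {x' : G.V n}
    (φ : ballGraph (G.graph m) T x ≃g ballGraph (G.graph n) T x')
    (hφ : φ (ballRoot (G.graph m) T x) = ballRoot (G.graph n) T x') {r : ℕ}
    (z : ball (G.graph m) T x) (hz : (z : G.V m) ∈ ball (G.graph m) r x) (hT : r + R ≤ T)
    (y : ball (G.graph m) T x) : h m z y = h n (φ z) (φ y) := by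
  by_cases hy : (y : G.V m) ∈ ball (G.graph m) R z
  · obtain ⟨ψ, hψ, hψy⟩ := exists_restrict φ hφ z hz R hT
    rw [hp m n z (φ z) ψ hψ ⟨y, hy⟩, hψy ⟨y, hy⟩ y.2]
  · rw [hr m z y hy, hr n (φ z) (φ y)]
    rwa [map_mem_ball_iff φ hφ z hz R hT]

theorem PatternInvariant.root_eq {K : Type*} [Zero K] {R : ℕ} {h : ∀ n, G.V n → G.V n → K}
    (hr : FiniteRange G R h) (hp : PatternInvariant G R h) {m n T : ℕ} {x : G.V m} {x' : G.V n}
    (φ : ballGraph (G.graph m) T x ≃g ballGraph (G.graph n) T x')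
    (hφ : φ (ballRoot (G.graph m) T x) = ballRoot (G.graph n) T x') (hT : R ≤ T)
    (y : ball (G.graph m) T x) : h m x y = h n x' (φ y) := by
  have := hp.apply_eq hr φ hφ (r := 0) (ballRoot _ T x) (self_mem_ball _ _ _) (by omega) y
  rw [hφ] at this
  exact this

theorem FiniteRange.mono {K : Type*} [Zero K] {R T : ℕ} {h : ∀ n, G.V n → G.V n → K}
    (hr : FiniteRange G R h) (hT : R ≤ T) : FiniteRange G T h := by
  intro n x y hy
  exact hr n x y fun h' => hy (mem_ball_trans h' (self_mem_ball _ 0 y) (by omega))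

/-- A sequence of complex matrices is a finite range, pattern invariant sequence. -/
def IsPatternKernel (G : GraphSeq.{u} d) (A : ∀ n, Matrix (G.V n) (G.V n) ℂ) : Prop :=
  ∃ R : ℕ, FiniteRange G R (fun n x y => A n x y) ∧ PatternInvariant G R (fun n x y => A n x y)

theorem IsPatternKernel.add {A B : ∀ n, Matrix (G.V n) (G.V n) ℂ} (hA : IsPatternKernel G A)
    (hB : IsPatternKernel G B) : IsPatternKernel G (A + B) := by
  obtain ⟨R, hr, hp⟩ := hA
  obtain ⟨S, hs, hq⟩ := hB
  refine ⟨max R S, fun n x y hy => ?_, fun m n x x' φ hφ y => ?_⟩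
  · have h1 := hr.mono (le_max_left R S) n x y hy
    have h2 := hs.mono (le_max_right R S) n x y hy
    simp only at h1 h2
    simp [h1, h2]
  · have h1 := hp.root_eq hr φ hφ (le_max_left R S) y
    have h2 := hq.root_eq hs φ hφ (le_max_right R S) y
    exact congrArg₂ (· + ·) h1 h2

theorem IsPatternKernel.mul {A B : ∀ n, Matrix (G.V n) (G.V n) ℂ} (hA : IsPatternKernel G A)
    (hB : IsPatternKernel G B) : IsPatternKernel G (A * B) := by
  classical
  obtain ⟨R, hr, hp⟩ := hA
  obtain ⟨S, hs, hq⟩ := hB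
  refine ⟨R + S, fun n x y hy => ?_, fun m n x x' φ hφ y => ?_⟩
  · simp only [Pi.mul_apply, Matrix.mul_apply]
    refine Finset.sum_eq_zero fun z _ => ?_
    by_cases hz : z ∈ ball (G.graph n) R x
    · have := hs n z y fun h => hy (mem_ball_trans hz h le_rfl)
      simp only at this
      simp [this]
    · have := hr n x z hz
      simp only at this
      simp [this]
  · have hsum : ∀ (k : ℕ) (v w : G.V k), (A * B) k v w =
        ∑ z : ball (G.graph k) (R + S) v, A k v z * B k z w := by
      intro k v w
      refine sum_eq_sum_subtype (ball (G.graph k) (R + S) v) (fun z => A k v z * B k z w) ?_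
      intro z hz
      have := hr.mono (Nat.le_add_right R S) k v z hz
      simp only at this
      simp only [this, zero_mul]
    refine (hsum m x y).trans (Eq.trans ?_ (hsum n x' (φ y)).symm)
    refine Fintype.sum_equiv φ.toEquiv _ _ fun z => ?_
    have h1 : A m x z = A n x' (φ z) := hp.root_eq hr φ hφ (Nat.le_add_right R S) z
    by_cases hz : (z : G.V m) ∈ ball (G.graph m) R x
    · have h2 : B m z y = B n (φ z) (φ y) := hq.apply_eq hs φ hφ z hz le_rfl y
      rw [h1, h2]
      rfl
    · have h3 : A m x z = 0 := hr m x z hz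
      rw [h3] at h1
      have h4 : A n x' (φ.toEquiv z) = 0 := h1.symm
      rw [h3, h4, zero_mul, zero_mul]

theorem IsPatternKernel.star {A : ∀ n, Matrix (G.V n) (G.V n) ℂ} (hA : IsPatternKernel G A) :
    IsPatternKernel G (star A) := by
  obtain ⟨R, hr, hp⟩ := hA
  refine ⟨R + R, fun n x y hy => ?_, fun m n x x' φ hφ y => ?_⟩
  · have := hr.mono (Nat.le_add_right R R) n y x fun h => hy (mem_ball_comm.1 h)
    simp only at this
    simp [this, Matrix.star_apply]
  · simp only [Pi.star_apply, Matrix.star_apply]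
    congr 1
    have hx : ((φ (ballRoot _ _ x) : ball (G.graph n) (R + R) x') : G.V n) = x' := by
      rw [hφ]; rfl
    by_cases hy : (y : G.V m) ∈ ball (G.graph m) R x
    · have := hp.apply_eq hr φ hφ y hy le_rfl (ballRoot _ _ x)
      rw [hx] at this
      exact this
    · have h1 := hr m y x fun h => hy (mem_ball_comm.1 h)
      have h2 := hr n (φ y) x' fun h => by
        have h3 := map_mem_ball_iff φ hφ (r := 0) (ballRoot _ _ x) (self_mem_ball _ _ _) R
          (by omega) y
        rw [hx] at h3
        exact hy (h3.1 (mem_ball_comm.1 h))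
      simp only at h1 h2
      rw [h1, h2]

theorem IsPatternKernel.algebraMap (c : ℂ) :
    IsPatternKernel G (algebraMap ℂ (∀ n, Matrix (G.V n) (G.V n) ℂ) c) := by
  refine ⟨0, fun n x y hy => ?_, fun m n x x' φ hφ y => ?_⟩
  · have : x ≠ y := fun h => hy (mem_ball_zero.2 h.symm)
    simp [Matrix.algebraMap_matrix_apply, this]
  · have hy : (y : G.V m) = x := mem_ball_zero.1 y.2
    have hy' : (φ y : G.V n) = x' := mem_ball_zero.1 (φ y).2
    simp only [Pi.algebraMap_apply, Matrix.algebraMap_matrix_apply, hy, hy', if_true]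

/-- The `*`-algebra of all sequences of finite range, pattern invariant operators on `G`. -/
def opAlgebra (G : GraphSeq.{u} d) : StarSubalgebra ℂ (∀ n, Matrix (G.V n) (G.V n) ℂ) where
  carrier := {A | IsPatternKernel G A}
  mul_mem' := IsPatternKernel.mul
  add_mem' := IsPatternKernel.add
  algebraMap_mem' := IsPatternKernel.algebraMap
  star_mem' := IsPatternKernel.star

/-- The element of the algebra given by a convergent operator sequence. -/
noncomputable def OperatorSeq.toAlgebra (H : OperatorSeq G) : opAlgebra G :=
  ⟨fun n => (H.matrix n).map Complex.ofReal, H.range,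
    fun n x y hy => by simp [OperatorSeq.matrix, H.finiteRange n x y hy],
    fun m n x x' φ hφ y => by
      simp [OperatorSeq.matrix, H.patternInvariant m n x x' φ hφ y]⟩

theorem OperatorSeq.toAlgebra_isSelfAdjoint (H : OperatorSeq G) : IsSelfAdjoint H.toAlgebra := by
  refine Subtype.ext ?_
  ext n x y
  simp [OperatorSeq.toAlgebra, OperatorSeq.matrix, Matrix.star_apply, H.symm n y x]

/-- The normalized trace of the `n`-th member of a sequence of operators. -/
noncomputable def normTrace (A : opAlgebra G) (n : ℕ) : ℂ :=
  (A.1 n).trace / (Fintype.card (G.V n) : ℂ)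

theorem isLocal_diag (A : opAlgebra G) : ∃ R, IsLocal G R fun n x => A.1 n x x := by
  obtain ⟨R, hr, hp⟩ := A.2
  refine ⟨R, ?_⟩
  rintro m n x x' ⟨φ, hφ⟩
  have := hp m n x x' φ hφ (ballRoot _ R x)
  rw [hφ] at this
  exact this

/-- The trace `tr_G` on the algebra of operator sequences: the limit of the normalized traces, which
exists by `tendsto_normTrace` below (and is `∑ α, p(α) h_α(root α)`). -/
noncomputable def trace (A : opAlgebra G) : ℂ :=
  Filter.atTop.limUnder (normTrace A)

theorem tendsto_normTrace (hG : G.WeaklyConvergent) (A : opAlgebra G) :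
    Filter.Tendsto (normTrace A) Filter.atTop (nhds (trace A)) := by
  obtain ⟨R, hR⟩ := isLocal_diag A
  exact tendsto_nhds_limUnder (hR.tendsto hG)

theorem trace_eq (hG : G.WeaklyConvergent) {A : opAlgebra G} {l : ℂ}
    (h : Filter.Tendsto (normTrace A) Filter.atTop (nhds l)) : trace A = l :=
  tendsto_nhds_unique (tendsto_normTrace hG A) h

theorem trace_add (hG : G.WeaklyConvergent) (A B : opAlgebra G) :
    trace (A + B) = trace A + trace B := by
  refine trace_eq hG (((tendsto_normTrace hG A).add (tendsto_normTrace hG B)).congr fun n => ?_)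
  simp [normTrace, Matrix.trace_add, add_div]

theorem trace_smul (hG : G.WeaklyConvergent) (c : ℂ) (A : opAlgebra G) :
    trace (c • A) = c * trace A := by
  refine trace_eq hG (((tendsto_normTrace hG A).const_mul c).congr fun n => ?_)
  simp [normTrace, Matrix.trace_smul, mul_div_assoc]

theorem trace_star (hG : G.WeaklyConvergent) (A : opAlgebra G) :
    trace (star A) = starRingEnd ℂ (trace A) := by
  refine trace_eq hG (((Complex.continuous_conj.tendsto _).comp
    (tendsto_normTrace hG A)).congr fun n => ?_)
  simp [normTrace, Matrix.star_eq_conjTranspose, Matrix.trace_conjTranspose]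

theorem normTrace_star_mul_self (A : opAlgebra G) (n : ℕ) :
    normTrace (star A * A) n =
      (((∑ z, ∑ x, ‖A.1 n x z‖ ^ 2) / (Fintype.card (G.V n) : ℝ) : ℝ) : ℂ) := by
  simp only [normTrace, Matrix.trace, Matrix.diag_apply, MulMemClass.coe_mul, StarMemClass.coe_star,
    Pi.mul_apply, Pi.star_apply, Matrix.mul_apply, Matrix.star_apply, Complex.ofReal_div,
    Complex.ofReal_sum, Complex.ofReal_natCast, Complex.ofReal_pow]
  congr 1
  refine Finset.sum_congr rfl fun z _ => Finset.sum_congr rfl fun x _ => ?_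
  exact Complex.conj_mul' _

theorem trace_star_mul_self_nonneg (hG : G.WeaklyConvergent) (A : opAlgebra G) :
    0 ≤ (trace (star A * A)).re := by
  refine ge_of_tendsto' ((Complex.continuous_re.tendsto _).comp
    (tendsto_normTrace hG (star A * A))) fun n => ?_
  simp only [Function.comp_apply, normTrace_star_mul_self, Complex.ofReal_re]
  positivity

/-- Left multiplication is bounded for the Hilbert-Schmidt seminorm. -/
theorem exists_bound (hG : G.WeaklyConvergent) (A : opAlgebra G) : ∃ C : ℝ, 0 ≤ C ∧
    ∀ B : opAlgebra G, (trace (star (A * B) * (A * B))).re ≤ C ^ 2 * (trace (star B * B)).re := by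
  classical
  obtain ⟨R, hr, -⟩ := A.2
  obtain ⟨R', hR'⟩ := isLocal_diag (A * star A)
  obtain ⟨S, hS, hS'⟩ := hR'.bounded
  have hrow : ∀ n x, ∑ y, ‖A.1 n x y‖ ^ 2 ≤ S := by
    intro n x
    refine le_trans (le_of_eq ?_) (hS' n x)
    have : (A * star A).1 n x x = ((∑ y, ‖A.1 n x y‖ ^ 2 : ℝ) : ℂ) := by
      simp only [MulMemClass.coe_mul, StarMemClass.coe_star, Pi.mul_apply, Pi.star_apply,
        Matrix.mul_apply, Matrix.star_apply, Complex.ofReal_sum, Complex.ofReal_pow]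
      exact Finset.sum_congr rfl fun y _ => Complex.mul_conj' _
    simp only [this, Complex.norm_real]
    rw [Real.norm_of_nonneg (Finset.sum_nonneg fun _ _ => by positivity)]
  refine ⟨√(S * (d + 1) ^ R), Real.sqrt_nonneg _, fun B => ?_⟩
  rw [Real.sq_sqrt (by positivity)]
  refine le_of_tendsto_of_tendsto' ((Complex.continuous_re.tendsto _).comp
    (tendsto_normTrace hG _)) (((Complex.continuous_re.tendsto _).comp
    (tendsto_normTrace hG (star B * B))).const_mul _) fun n => ?_
  simp only [Function.comp_apply, normTrace_star_mul_self, Complex.ofReal_re]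
  rw [← mul_div_assoc]
  refine div_le_div_of_nonneg_right ?_ (Nat.cast_nonneg _)
  rw [Finset.mul_sum]
  refine Finset.sum_le_sum fun z _ => ?_
  have hentry : ∀ x, ‖(A * B).1 n x z‖ ^ 2 ≤
      S * ∑ y, if y ∈ ball (G.graph n) R x then ‖B.1 n y z‖ ^ 2 else 0 := by
    intro x
    have h1 : ‖(A * B).1 n x z‖ ≤
        ∑ y, ‖A.1 n x y‖ * (if y ∈ ball (G.graph n) R x then ‖B.1 n y z‖ else 0) := by
      simp only [MulMemClass.coe_mul, Pi.mul_apply, Matrix.mul_apply]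
      refine (norm_sum_le _ _).trans (Finset.sum_le_sum fun y _ => ?_)
      rw [norm_mul]
      by_cases hy : y ∈ ball (G.graph n) R x
      · simp [hy]
      · have := hr n x y hy
        simp only at this
        simp [this]
    calc ‖(A * B).1 n x z‖ ^ 2 ≤ _ := pow_le_pow_left₀ (norm_nonneg _) h1 2
      _ ≤ (∑ y, ‖A.1 n x y‖ ^ 2) *
          ∑ y, (if y ∈ ball (G.graph n) R x then ‖B.1 n y z‖ else 0) ^ 2 :=
        Finset.sum_mul_sq_le_sq_mul_sq _ _ _
      _ ≤ S * ∑ y, (if y ∈ ball (G.graph n) R x then ‖B.1 n y z‖ else 0) ^ 2 :=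
        mul_le_mul_of_nonneg_right (hrow n x) (Finset.sum_nonneg fun _ _ => sq_nonneg _)
      _ = _ := by simp only [ite_pow, ne_eq, OfNat.ofNat_ne_zero, not_false_eq_true, zero_pow]
  refine (Finset.sum_le_sum fun x _ => hentry x).trans ?_
  rw [← Finset.mul_sum, Finset.sum_comm, mul_assoc, Finset.mul_sum (a := ((d : ℝ) + 1) ^ R)]
  refine mul_le_mul_of_nonneg_left (Finset.sum_le_sum fun y _ => ?_) hS
  rw [← Finset.sum_filter, Finset.sum_const, nsmul_eq_mul]
  refine mul_le_mul_of_nonneg_right ?_ (by positivity)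
  have h2 : (Finset.univ.filter fun x => y ∈ ball (G.graph n) R x).card =
      (ball (G.graph n) R y).ncard := by
    rw [← Set.ncard_coe_finset]
    congr 1
    ext x
    simp [mem_ball_comm (x := x)]
  rw [h2]
  exact_mod_cast ncard_ball_le (G.degree_le n) R y

end Algebra

/-! ### The Hilbert space, the von Neumann algebra and the integrated density of states -/

section Hilbert

variable {d : ℕ} {G : GraphSeq.{u} d}

/-- The algebra of operator sequences, regarded as a vector space with the (positive semidefinite)
inner product `⟨A, B⟩ = tr_G (A* B)`. It is a type synonym. -/
@[nolint unusedArguments]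
def PreHilbert (_hG : G.WeaklyConvergent) : Type u := opAlgebra G

noncomputable instance (hG : G.WeaklyConvergent) : AddCommGroup (PreHilbert hG) :=
  inferInstanceAs (AddCommGroup (opAlgebra G))

noncomputable instance (hG : G.WeaklyConvergent) : Module ℂ (PreHilbert hG) :=
  inferInstanceAs (Module ℂ (opAlgebra G))

/-- The identification of the algebra with the pre-Hilbert space. -/
noncomputable def toPre (hG : G.WeaklyConvergent) : opAlgebra G ≃ₗ[ℂ] PreHilbert hG := LinearEquiv.refl ℂ _

noncomputable abbrev preCore (hG : G.WeaklyConvergent) :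
    PreInnerProductSpace.Core ℂ (PreHilbert hG) where
  inner A B := trace (star ((toPre hG).symm A) * (toPre hG).symm B)
  conj_inner_symm A B := by rw [← trace_star hG, star_mul, star_star]
  re_inner_nonneg A := trace_star_mul_self_nonneg hG _
  add_left A B C := by rw [map_add, star_add, add_mul, trace_add hG]
  smul_left A B c := by rw [map_smul, star_smul, smul_mul_assoc, trace_smul hG]; rfl

noncomputable instance (hG : G.WeaklyConvergent) : SeminormedAddCommGroup (PreHilbert hG) :=
  InnerProductSpace.Core.toSeminormedAddCommGroup (c := preCore hG)

noncomputable instance (hG : G.WeaklyConvergent) : InnerProductSpace ℂ (PreHilbert hG) :=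
  InnerProductSpace.ofCore (preCore hG)

theorem pre_inner_def (hG : G.WeaklyConvergent) (A B : PreHilbert hG) :
    inner ℂ A B = trace (star ((toPre hG).symm A) * (toPre hG).symm B) := rfl

theorem pre_norm_def (hG : G.WeaklyConvergent) (A : PreHilbert hG) :
    ‖A‖ = √(trace (star ((toPre hG).symm A) * (toPre hG).symm A)).re := rfl

/-- The Hilbert space completion. Forming it identifies sequences at distance `0`, that is, sequences
whose difference is a null operator sequence. -/
abbrev Hilbert (hG : G.WeaklyConvergent) : Type u := UniformSpace.Completion (PreHilbert hG)

/-- Left multiplication by `A` on the pre-Hilbert space. -/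
noncomputable def leftMulPre (hG : G.WeaklyConvergent) (A : opAlgebra G) :
    PreHilbert hG →L[ℂ] PreHilbert hG :=
  ((toPre hG).toLinearMap ∘ₗ LinearMap.mulLeft ℂ A ∘ₗ (toPre hG).symm.toLinearMap).mkContinuous
    (exists_bound hG A).choose fun B => by
      obtain ⟨h0, h⟩ := (exists_bound hG A).choose_spec
      rw [pre_norm_def, pre_norm_def, ← Real.sqrt_sq h0, ← Real.sqrt_mul (sq_nonneg _)]
      exact Real.sqrt_le_sqrt (h _)

theorem leftMulPre_apply (hG : G.WeaklyConvergent) (A : opAlgebra G) (B : PreHilbert hG) :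
    leftMulPre hG A B = toPre hG (A * (toPre hG).symm B) := rfl

/-- The representation `A ↦ [A]` of the algebra by left multiplication operators on the Hilbert
space. -/
noncomputable def leftRep (hG : G.WeaklyConvergent) :
    opAlgebra G →⋆ₐ[ℂ] (Hilbert hG →L[ℂ] Hilbert hG) where
  toFun A := (leftMulPre hG A).completion
  map_one' := by
    ext C
    induction C using UniformSpace.Completion.induction_on with
    | hp => apply isClosed_eq <;> fun_prop
    | ih C => simp [leftMulPre_apply]
  map_mul' A B := by
    ext C
    induction C using UniformSpace.Completion.induction_on with
    | hp => apply isClosed_eq <;> fun_prop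
    | ih C => simp [leftMulPre_apply, mul_assoc]
  map_zero' := by
    ext C
    induction C using UniformSpace.Completion.induction_on with
    | hp => apply isClosed_eq <;> fun_prop
    | ih C => simp [leftMulPre_apply, UniformSpace.Completion.coe_zero]
  map_add' A B := by
    ext C
    induction C using UniformSpace.Completion.induction_on with
    | hp => apply isClosed_eq <;> fun_prop
    | ih C => simp [leftMulPre_apply, add_mul, UniformSpace.Completion.coe_add]
  commutes' c := by
    ext C
    induction C using UniformSpace.Completion.induction_on with
    | hp => apply isClosed_eq <;> fun_prop
    | ih C => simp [leftMulPre_apply, Algebra.algebraMap_eq_smul_one, UniformSpace.Completion.coe_smul]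
  map_star' A := by
    refine (ContinuousLinearMap.eq_adjoint_iff _ _).mpr fun B C => ?_
    induction B, C using UniformSpace.Completion.induction_on₂ with
    | hp => apply isClosed_eq <;> fun_prop
    | ih B C => simp [leftMulPre_apply, mul_assoc, pre_inner_def]

/-- The von Neumann algebra generated by the left multiplication operators (their double commutant,
that is, their weak closure). -/
noncomputable def vonNeumann (hG : G.WeaklyConvergent) : VonNeumannAlgebra (Hilbert hG) where
  toStarSubalgebra := StarSubalgebra.centralizer ℂ
    (StarSubalgebra.centralizer ℂ (Set.range (leftRep hG)) : Set (Hilbert hG →L[ℂ] Hilbert hG))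
  centralizer_centralizer' := by
    change Set.centralizer (Set.centralizer
      (StarSubalgebra.centralizer ℂ (StarSubalgebra.centralizer ℂ (Set.range (leftRep hG)) :
        Set (Hilbert hG →L[ℂ] Hilbert hG)) : Set (Hilbert hG →L[ℂ] Hilbert hG))) =
      (StarSubalgebra.centralizer ℂ (StarSubalgebra.centralizer ℂ (Set.range (leftRep hG)) :
        Set (Hilbert hG →L[ℂ] Hilbert hG)) : Set (Hilbert hG →L[ℂ] Hilbert hG))
    rw [StarSubalgebra.coe_centralizer_centralizer]
    simp

/-- The trace on the von Neumann algebra, `tr T = ⟨T 1, 1⟩` (the inner product is linear in the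
second argument). -/
noncomputable def vnTrace (hG : G.WeaklyConvergent) (T : vonNeumann hG) : ℂ :=
  inner ℂ ((toPre hG 1 : PreHilbert hG) : Hilbert hG)
    ((T : Hilbert hG →L[ℂ] Hilbert hG) ((toPre hG 1 : PreHilbert hG) : Hilbert hG))

end Hilbert

/-- The spectral projection of a bounded self-adjoint operator `T` for `(-∞, t]`, as the orthogonal
projection onto the kernel of the positive part `(T - t)⁺`, which is given by the continuous
functional calculus. -/
noncomputable def spectralProjection {E : Type*} [NormedAddCommGroup E] [InnerProductSpace ℂ E]
    [CompleteSpace E] (T : E →L[ℂ] E) (t : ℝ) : E →L[ℂ] E :=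
  (cfc (fun s : ℝ => max (s - t) 0) T).ker.starProjection

theorem spectralProjection_commute {E : Type*} [NormedAddCommGroup E] [InnerProductSpace ℂ E]
    [CompleteSpace E] {T S : E →L[ℂ] E} (hS : Commute T S) (hS' : Commute T (star S)) (t : ℝ) :
    Commute (spectralProjection T t) S := by
  have inv : ∀ U : E →L[ℂ] E, Commute T U → ∀ w ∈ (cfc (fun s : ℝ => max (s - t) 0) T).ker,
      U w ∈ (cfc (fun s : ℝ => max (s - t) 0) T).ker := by
    intro U hU w hw
    have hc := DFunLike.congr_fun (hU.cfc_real fun s : ℝ => max (s - t) 0).eq w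
    simp only [mul_apply_eq_comp] at hc
    have hw' : (cfc (fun s : ℝ => max (s - t) 0) T) w = 0 := hw
    change (cfc (fun s : ℝ => max (s - t) 0) T) (U w) = 0
    rw [hc, hw', map_zero]
  ext v
  simp only [mul_apply_eq_comp, spectralProjection]
  refine (Submodule.eq_starProjection_of_mem_orthogonal
    (inv S hS _ (Submodule.starProjection_apply_mem _ v)) ?_)
  rw [← map_sub, Submodule.mem_orthogonal]
  intro w hw
  rw [← ContinuousLinearMap.adjoint_inner_left]
  exact (Submodule.sub_starProjection_mem_orthogonal v) _ (inv _ hS' w hw)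

section IDS

variable {d : ℕ} {G : GraphSeq.{u} d}

/-- The limit operator `[H]` on the Hilbert space. -/
noncomputable def OperatorSeq.limitOperator (H : OperatorSeq G) (hG : G.WeaklyConvergent) :
    Hilbert hG →L[ℂ] Hilbert hG :=
  leftRep hG H.toAlgebra

theorem OperatorSeq.limitOperator_isSelfAdjoint (H : OperatorSeq G) (hG : G.WeaklyConvergent) :
    IsSelfAdjoint (H.limitOperator hG) :=
  H.toAlgebra_isSelfAdjoint.map (leftRep hG)

theorem OperatorSeq.spectralProjection_mem (H : OperatorSeq G) (hG : G.WeaklyConvergent) (t : ℝ) :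
    spectralProjection (H.limitOperator hG) t ∈ vonNeumann hG := by
  change _ ∈ StarSubalgebra.centralizer ℂ
    (StarSubalgebra.centralizer ℂ (Set.range (leftRep hG)) : Set (Hilbert hG →L[ℂ] Hilbert hG))
  have key : ∀ S ∈ StarSubalgebra.centralizer ℂ (Set.range (leftRep hG)),
      Commute (spectralProjection (H.limitOperator hG) t) S := by
    intro S hS
    have hS' := star_mem hS
    rw [StarSubalgebra.mem_centralizer_iff] at hS hS'
    exact spectralProjection_commute (hS _ ⟨H.toAlgebra, rfl⟩).1 (hS' _ ⟨H.toAlgebra, rfl⟩).1 t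
  rw [StarSubalgebra.mem_centralizer_iff]
  exact fun S hS => ⟨(key S hS).symm.eq, (key _ (star_mem hS)).symm.eq⟩

/-- The integrated density of states of the limit operator: the trace of the spectral projection
for `(-∞, t]` (the trace of a projection is real). -/
noncomputable def OperatorSeq.ids (H : OperatorSeq G) (hG : G.WeaklyConvergent) (t : ℝ) : ℝ :=
  (vnTrace hG ⟨spectralProjection (H.limitOperator hG) t, H.spectralProjection_mem hG t⟩).re

end IDS

end GraphLimit

/-! Two independent mechanisms combine.

Weak convergence of spectral distributions. The $k$-th moment of the eigenvalue distribution of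
$H_n$ is the normalized trace of $H_n^k$. It converges to $\operatorname{tr}_{\mathcal G}(\mathcal
H^k)=\langle\mathbf 1,[\mathcal H]^k\mathbf 1\rangle$ because powers of $\mathcal H$ stay in the
algebra. All spectra lie in one bounded interval, so Weierstrass approximation extends this to every
continuous function (`OperatorSeq.tendsto_average`). By itself this controls the distribution
functions only at continuity points of the limit.

Hyperfiniteness handles the jumps. Cutting few edges makes $H_n$ block diagonal with blocks of size
at most $K$. The kernels take finitely many values altogether, so finitely many blocks can occur,
and the eigenvalues of all the cut matrices lie in one finite set $\Lambda$ independent of $n$.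
Cutting changes few columns, and a rank argument (`card_eigenvalues_le`) shows that the counting
function moves by little. Hence $N_{H_n}$ is almost constant between consecutive points of
$\Lambda$, uniformly in $n$: this is `EquiStep`, proved in `OperatorSeq.equiStep_counting`.

`EquiStep` is used twice. It absorbs the shift from $t$ to $t+1/(k+1)$ caused by replacing an
indicator by a continuous ramp, which gives convergence at every $t$, jumps included. It also
reduces uniform convergence to finitely many points. The limit is identified through the strong
convergence of the ramps of $[\mathcal H]$ to the spectral projection (`tendsto_cfc_ramp`). -/

namespace GraphLimit

/-! ### From pointwise to uniform convergence -/

/-- A sequence of functions is nearly constant, uniformly along the sequence, on the complementary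
intervals `[l, l')` of suitable finite sets. -/
def EquiStep (F : ℕ → ℝ → ℝ) : Prop :=
  ∀ ε > 0, ∃ Λ : Finset ℝ, ∀ n s t, s ≤ t → (∀ l ∈ Λ, ¬ (s < l ∧ l ≤ t)) → |F n t - F n s| ≤ ε

/-- The set $\Lambda$ cuts the line into finitely many intervals. On each of them every `F n`, and
hence the limit `f`, oscillates by at most $\varepsilon/4$, so convergence at one representative per
interval is enough. -/
theorem EquiStep.tendstoUniformly {F : ℕ → ℝ → ℝ} {f : ℝ → ℝ} (hF : EquiStep F)
    (h : ∀ t, Filter.Tendsto (fun n => F n t) Filter.atTop (nhds (f t))) :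
    TendstoUniformly F f Filter.atTop := by
  classical
  rw [Metric.tendstoUniformly_iff]
  intro ε hε
  obtain ⟨Λ, hΛ⟩ := hF (ε / 4) (by positivity)
  -- The points of $\Lambda$ at or below `t` label the interval $[l,l')$ that contains `t`.
  let cls : ℝ → Finset ℝ := fun t => Λ.filter (· ≤ t)
  have hcls : ∀ s t, cls s = cls t → ∀ n, |F n t - F n s| ≤ ε / 4 := by
    have aux : ∀ s t, s ≤ t → cls s = cls t → ∀ n, |F n t - F n s| ≤ ε / 4 := by
      intro s t hst hc n
      refine hΛ n s t hst fun l hl hlt => ?_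
      have : l ∈ cls s := hc ▸ Finset.mem_filter.2 ⟨hl, hlt.2⟩
      exact absurd (Finset.mem_filter.1 this).2 (not_le.2 hlt.1)
    intro s t hc n
    rcases le_total s t with hst | hst
    · exact aux s t hst hc n
    · rw [abs_sub_comm]
      exact aux t s hst hc.symm n
  have hlim : ∀ s t, cls s = cls t → |f t - f s| ≤ ε / 4 := fun s t hc =>
    le_of_tendsto' ((h t).sub (h s)).abs (hcls s t hc)
  -- The default 0 serves subsets of $\Lambda$ that label no interval; convergence there is
  -- harmless.
  let rep : Finset ℝ → ℝ := fun c => if hc : ∃ t, cls t = c then hc.choose else 0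
  have hrep : ∀ t, cls (rep (cls t)) = cls t := by
    intro t
    have hc : ∃ s, cls s = cls t := ⟨t, rfl⟩
    simp only [rep, dif_pos hc]
    exact hc.choose_spec
  have hev : ∀ᶠ n in Filter.atTop, ∀ c ∈ Λ.powerset, |F n (rep c) - f (rep c)| < ε / 4 := by
    rw [Filter.eventually_all_finset]
    intro c _
    have := (Metric.tendsto_nhds.1 (h (rep c))) (ε / 4) (by positivity)
    simpa only [Real.dist_eq] using this
  filter_upwards [hev] with n hn t
  have h1 := hn (cls t) (Finset.mem_powerset.2 (Finset.filter_subset _ _))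
  have h2 := hcls _ _ (hrep t) n
  have h3 := hlim _ _ (hrep t)
  rw [Real.dist_eq]
  rw [abs_lt] at h1 ⊢
  rw [abs_le] at h2 h3
  constructor <;> linarith

/-- The sandwich alone would lose a shift to the right. Since $\Lambda$ is finite, $(t,t+1/(k+1)]$
misses it for large `k`, even if `t` itself is in $\Lambda$, so the shift costs at most
$\varepsilon/4$ uniformly in `n`. Thus `k` is fixed before `n` grows, and `f` may jump at `t`. -/
theorem EquiStep.tendsto {F : ℕ → ℝ → ℝ} {f : ℝ → ℝ} (hF : EquiStep F)
    {a : ℕ → ℝ → ℕ → ℝ} {L : ℝ → ℕ → ℝ} (h₁ : ∀ n t k, F n t ≤ a n t k)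
    (h₂ : ∀ n t k, a n t k ≤ F n (t + 1 / ((k : ℝ) + 1)))
    (ha : ∀ t k, Filter.Tendsto (fun n => a n t k) Filter.atTop (nhds (L t k)))
    (hL : ∀ t, Filter.Tendsto (L t) Filter.atTop (nhds (f t))) (t : ℝ) :
    Filter.Tendsto (fun n => F n t) Filter.atTop (nhds (f t)) := by
  rw [Metric.tendsto_nhds]
  intro ε hε
  obtain ⟨Λ, hΛ⟩ := hF (ε / 4) (by positivity)
  have hgap : ∀ᶠ k : ℕ in Filter.atTop, ∀ l ∈ Λ, ¬ (t < l ∧ l ≤ t + 1 / ((k : ℝ) + 1)) := by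
    rw [Filter.eventually_all_finset]
    intro l _
    by_cases hl : t < l
    · have := (tendsto_one_div_add_atTop_nhds_zero_nat (𝕜 := ℝ)).eventually
        (gt_mem_nhds (sub_pos.2 hl))
      filter_upwards [this] with k hk h
      linarith [h.2]
    · exact Filter.Eventually.of_forall fun k h => hl h.1
  obtain ⟨k, hk, hk'⟩ :=
    (hgap.and (Metric.tendsto_nhds.1 (hL t) (ε / 4) (by positivity))).exists
  filter_upwards [Metric.tendsto_nhds.1 (ha t k) (ε / 4) (by positivity)] with n hn
  have h3 := hΛ n t (t + 1 / ((k : ℝ) + 1)) (le_add_of_nonneg_right (by positivity)) hk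
  have h4 := h₁ n t k
  have h5 := h₂ n t k
  rw [Real.dist_eq, abs_lt] at *
  rw [abs_le] at h3
  constructor <;> linarith

/-! ### Eigenvalues of real symmetric matrices -/

/-- Eigenvalues are bounded by the row sums. -/
theorem abs_eigenvalue_le {V : Type*} [Fintype V] {A : Matrix V V ℝ} {M t : ℝ}
    (hM : ∀ x, ∑ y, |A x y| ≤ M) {v : V → ℝ} (hv : v ≠ 0) (h : A.mulVec v = t • v) : |t| ≤ M := by
  obtain ⟨x₀, hx₀⟩ := Function.ne_iff.1 hv
  -- The row at a coordinate where `|v|` is maximal gives the bound.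
  obtain ⟨x, -, hx⟩ := Finset.exists_max_image Finset.univ (fun x => |v x|) ⟨x₀, Finset.mem_univ _⟩
  have hpos : 0 < |v x| := lt_of_lt_of_le (abs_pos.2 hx₀) (hx x₀ (Finset.mem_univ _))
  have h1 : ∑ y, A x y * v y = t * v x := congrFun h x
  have h2 : |t| * |v x| ≤ M * |v x| := by
    rw [← abs_mul, ← h1]
    refine (Finset.abs_sum_le_sum_abs _ _).trans ?_
    refine le_trans ?_ (mul_le_mul_of_nonneg_right (hM x) hpos.le)
    rw [Finset.sum_mul]
    refine Finset.sum_le_sum fun y _ => ?_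
    rw [abs_mul]
    exact mul_le_mul_of_nonneg_left (hx y (Finset.mem_univ _)) (abs_nonneg _)
  exact le_of_mul_le_mul_right h2 hpos

section Eigenvalues

variable {V : Type*} [Fintype V] [DecidableEq V]

/-- The quadratic form of a symmetric matrix in an eigenbasis. -/
theorem inner_toEuclideanLin_eq {A : Matrix V V ℝ} (hA : A.IsHermitian) (x : EuclideanSpace ℝ V) :
    inner ℝ x (A.toEuclideanLin x) =
      ∑ i, hA.eigenvalues i * inner ℝ (hA.eigenvectorBasis i) x ^ 2 := by
  rw [← hA.eigenvectorBasis.sum_inner_mul_inner]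
  refine Finset.sum_congr rfl fun i _ => ?_
  have h1 : A.toEuclideanLin (hA.eigenvectorBasis i) =
      hA.eigenvalues i • hA.eigenvectorBasis i := by
    ext j
    exact congrFun (hA.mulVec_eigenvectorBasis i) j
  rw [← (Matrix.isSymmetric_toEuclideanLin_iff.2 hA) (hA.eigenvectorBasis i) x, h1,
    real_inner_smul_left, real_inner_comm]
  ring

theorem sum_inner_eigenvectorBasis_sq {A : Matrix V V ℝ} (hA : A.IsHermitian)
    (x : EuclideanSpace ℝ V) :
    ∑ i, inner ℝ (hA.eigenvectorBasis i) x ^ 2 = ‖x‖ ^ 2 := by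
  rw [← hA.eigenvectorBasis.sum_sq_norm_inner_right x]
  simp

/-- Changing the columns of a symmetric matrix in a set `s` changes the number of the eigenvalues
below `t` by at most the cardinality of `s`. -/
theorem card_eigenvalues_le {A B : Matrix V V ℝ} (hA : A.IsHermitian) (hB : B.IsHermitian)
    (s : Finset V) (h : ∀ x y, y ∉ s → A x y = B x y) (t : ℝ) :
    (Finset.univ.filter fun i => hA.eigenvalues i ≤ t).card ≤
      (Finset.univ.filter fun i => hB.eigenvalues i ≤ t).card + s.card := by
  -- A vector killed by `L` has $\langle x,Ax\rangle\le t\|x\|^2$, satisfies $Ax=Bx$ because it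
  -- vanishes on `s`, and has only components with eigenvalue $>t$ in the eigenbasis of `B`; so it
  -- is zero. Injectivity of `L` gives $|V|\le\#\{\lambda_i(A)>t\}+\#\{\lambda_i(B)\le t\}+|s|$,
  -- which is the claim.
  let L : EuclideanSpace ℝ V →ₗ[ℝ]
      (({i // ¬ hA.eigenvalues i ≤ t} ⊕ {i // hB.eigenvalues i ≤ t}) ⊕ s → ℝ) :=
    LinearMap.pi (Sum.elim (Sum.elim
      (fun i => (innerSL ℝ (hA.eigenvectorBasis i)).toLinearMap)
      (fun i => (innerSL ℝ (hB.eigenvectorBasis i)).toLinearMap))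
      (fun y => (EuclideanSpace.proj (𝕜 := ℝ) (y : V)).toLinearMap))
  have hL : Function.Injective L := by
    refine (injective_iff_map_eq_zero L).2 fun x hx => ?_
    have hx1 : ∀ i, ¬ hA.eigenvalues i ≤ t → inner ℝ (hA.eigenvectorBasis i) x = 0 :=
      fun i hi => congrFun hx (Sum.inl (Sum.inl ⟨i, hi⟩))
    have hx2 : ∀ i, hB.eigenvalues i ≤ t → inner ℝ (hB.eigenvectorBasis i) x = 0 :=
      fun i hi => congrFun hx (Sum.inl (Sum.inr ⟨i, hi⟩))
    have hx3 : ∀ y ∈ s, x y = 0 := fun y hy => congrFun hx (Sum.inr ⟨y, hy⟩)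
    have hAB : A.toEuclideanLin x = B.toEuclideanLin x := by
      ext v
      change (A.mulVec x.ofLp) v = (B.mulVec x.ofLp) v
      refine Finset.sum_congr rfl fun y _ => ?_
      by_cases hy : y ∈ s
      · simp [hx3 y hy]
      · exact congrArg (· * x y) (h v y hy)
    have hqA : inner ℝ x (A.toEuclideanLin x) ≤ t * ‖x‖ ^ 2 := by
      rw [inner_toEuclideanLin_eq hA, ← sum_inner_eigenvectorBasis_sq hA, Finset.mul_sum]
      refine Finset.sum_le_sum fun i _ => ?_
      by_cases hi : hA.eigenvalues i ≤ t
      · exact mul_le_mul_of_nonneg_right hi (sq_nonneg _)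
      · simp [hx1 i hi]
    rw [hAB, inner_toEuclideanLin_eq hB, ← sum_inner_eigenvectorBasis_sq hB, Finset.mul_sum,
      ← sub_nonpos, ← Finset.sum_sub_distrib] at hqA
    have hnn : ∀ i ∈ Finset.univ, 0 ≤ hB.eigenvalues i * inner ℝ (hB.eigenvectorBasis i) x ^ 2 -
        t * inner ℝ (hB.eigenvectorBasis i) x ^ 2 := by
      intro i _
      by_cases hi : hB.eigenvalues i ≤ t
      · simp [hx2 i hi]
      · rw [← sub_mul]
        exact mul_nonneg (by linarith) (sq_nonneg _)
    have hz := (Finset.sum_eq_zero_iff_of_nonneg hnn).1 (le_antisymm hqA (Finset.sum_nonneg hnn))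
    have hall : ∀ i, inner ℝ (hB.eigenvectorBasis i) x = 0 := by
      intro i
      by_cases hi : hB.eigenvalues i ≤ t
      · exact hx2 i hi
      · have := hz i (Finset.mem_univ i)
        rw [← sub_mul, mul_eq_zero] at this
        rcases this with h0 | h0
        · exact absurd (sub_eq_zero.1 h0).le hi
        · exact pow_eq_zero_iff two_ne_zero |>.1 h0
    have hnorm := sum_inner_eigenvectorBasis_sq hB x
    simp only [hall] at hnorm
    simpa using hnorm.symm
  have hdim := LinearMap.finrank_le_finrank_of_injective hL
  simp only [finrank_euclideanSpace, Module.finrank_fintype_fun_eq_card, Fintype.card_sum,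
    Fintype.card_subtype, Finset.filter_univ_mem] at hdim
  have hsplit := Finset.card_filter_add_card_filter_not (s := (Finset.univ : Finset V))
    (fun i => hA.eigenvalues i ≤ t)
  rw [Finset.card_univ] at hsplit
  omega

theorem abs_card_eigenvalues_sub_le {A B : Matrix V V ℝ} (hA : A.IsHermitian)
    (hB : B.IsHermitian) (s : Finset V) (h : ∀ x y, y ∉ s → A x y = B x y) (t : ℝ) :
    |((Finset.univ.filter fun i => hA.eigenvalues i ≤ t).card : ℝ) -
      (Finset.univ.filter fun i => hB.eigenvalues i ≤ t).card| ≤ s.card := by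
  have h1 : _ ≤ _ := (Nat.cast_le (α := ℝ)).2 (card_eigenvalues_le hA hB s h t)
  have h2 : _ ≤ _ := (Nat.cast_le (α := ℝ)).2
    (card_eigenvalues_le hB hA s (fun x y hy => (h x y hy).symm) t)
  push_cast at h1 h2
  rw [abs_le]
  constructor <;> linarith

theorem trace_pow_eq_sum_eigenvalues {A : Matrix V V ℝ} (hA : A.IsHermitian) (k : ℕ) :
    (A ^ k).trace = ∑ i, hA.eigenvalues i ^ k := by
  conv_lhs => rw [hA.spectral_theorem]
  rw [← map_pow, Unitary.conjStarAlgAut_apply, Matrix.trace_mul_cycle, Unitary.coe_star_mul_self,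
    one_mul, Matrix.diagonal_pow, Matrix.trace_diagonal]
  simp

theorem eigenvectorBasis_ofLp_ne_zero {A : Matrix V V ℝ} (hA : A.IsHermitian) (i : V) :
    (hA.eigenvectorBasis i).ofLp ≠ 0 := by
  intro h
  refine hA.eigenvectorBasis.orthonormal.ne_zero i ?_
  ext j
  exact congrFun h j

end Eigenvalues

/-- Block diagonal matrices with blocks of bounded size and entries in a finite set have their
eigenvalues in a finite set. -/
theorem exists_finset_eigenvalues {S : Set ℝ} (hS : S.Finite) (K : ℕ) :
    ∃ Λ : Finset ℝ, ∀ (V : Type u) [Fintype V] (A : Matrix V V ℝ) (v : V → ℝ) (t : ℝ) (c : Set V),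
      (∀ x y, A x y ∈ S) → c.ncard ≤ K → (∀ x ∈ c, ∀ y, y ∉ c → A x y = 0) →
      (∃ x ∈ c, v x ≠ 0) → A.mulVec v = t • v → t ∈ Λ := by
  classical
  have := hS.to_subtype
  -- Blocks are transported to `Fin k` with $k\le K$, so that finitely many matrices serve all
  -- vertex types at once.
  have hfin : (⋃ a : (Σ k : Fin (K + 1), Fin k → Fin k → S),
      {t : ℝ | Module.End.HasEigenvalue
        (Matrix.toLin' (Matrix.of fun i j => ((a.2 i j : S) : ℝ))) t}).Finite :=
    Set.finite_iUnion fun a => Module.End.finite_hasEigenvalue _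
  refine ⟨hfin.toFinset, fun V _ A v t c hA hc hblock hv h => ?_⟩
  rw [Set.Finite.mem_toFinset, Set.mem_iUnion]
  let e : c ≃ Fin c.ncard := Finite.equivFinOfCardEq (Nat.card_coe_set_eq _)
  refine ⟨⟨⟨c.ncard, Nat.lt_succ_of_le hc⟩, fun i j =>
    ⟨A (e.symm i) (e.symm j), hA _ _⟩⟩, ?_⟩
  obtain ⟨x, hx, hvx⟩ := hv
  -- The restriction of `v` to `c` is an eigenvector of the block: the rows in `c` vanish off `c`,
  -- and `v` is nonzero somewhere on `c`.
  refine Module.End.hasEigenvalue_of_hasEigenvector (x := fun i => v (e.symm i))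
    ⟨Module.End.mem_eigenspace_iff.2 ?_, ?_⟩
  · ext i
    have h1 : ∑ y, A (e.symm i) y * v y = t * v (e.symm i) := congrFun h _
    simp only [Matrix.toLin'_apply, Matrix.mulVec, dotProduct, Matrix.of_apply, Pi.smul_apply,
      smul_eq_mul]
    rw [← h1, Equiv.sum_comp e.symm (fun y : c => A (e.symm i) y * v y)]
    rw [← Finset.sum_subtype (Finset.univ.filter fun y => y ∈ c) (by simp)
      (fun y => A (e.symm i) y * v y)]
    refine Finset.sum_filter_of_ne fun y _ hy => ?_
    by_contra hyc
    exact hy (by rw [hblock _ (e.symm i).2 y hyc, zero_mul])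
  · intro h0
    refine hvx ?_
    have := congrFun h0 (e ⟨x, hx⟩)
    simpa using this

/-! ### Eigenvalue counting and cutting of edges -/

section Cutting

variable {d : ℕ} {G : GraphSeq.{u} d}

/-- Pattern invariance leaves only finitely many kernel values along the whole sequence. -/
theorem OperatorSeq.finite_values (H : OperatorSeq G) :
    {a : ℝ | ∃ n x y, H.kernel n x y = a}.Finite := by
  obtain ⟨s, hs⟩ := exists_patterns G H.range
  -- `T α i` collects the kernel values at position `i` of the pattern `α`. Two occurrences of `α`
  -- differ by a rooted isomorphism of balls, so pattern invariance leaves at most one value.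
  let T : (α : RootedGraph) → Fin α.size → Set ℝ := fun α i =>
    {a | ∃ (n : ℕ) (x : G.V n) (φ : ballGraph (G.graph n) H.range x ≃g α.graph)
      (y : ball (G.graph n) H.range x),
      φ (ballRoot (G.graph n) H.range x) = α.root ∧ φ y = i ∧ H.kernel n x y = a}
  have hT : ∀ α i, (T α i).Subsingleton := by
    rintro α i a ⟨n, x, φ, y, hφ, hy, rfl⟩ b ⟨m, x', φ', y', hφ', hy', rfl⟩
    have h1 : (φ.trans φ'.symm) (ballRoot (G.graph n) H.range x) =
        ballRoot (G.graph m) H.range x' := by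
      simp [hφ, ← hφ']
    have h2 : (φ.trans φ'.symm) y = y' := by
      simp [hy, ← hy']
    rw [H.patternInvariant n m x x' _ h1 y, h2]
  have hfin : (⋃ α ∈ s, ⋃ i, T α i).Finite :=
    s.finite_toSet.biUnion fun α _ => Set.finite_iUnion fun i => (hT α i).finite
  refine (hfin.insert 0).subset ?_
  rintro a ⟨n, x, y, rfl⟩
  by_cases hy : y ∈ ball (G.graph n) H.range x
  · right
    obtain ⟨α, ⟨hα, φ, hφ⟩, -⟩ := hs n x
    simp only [Set.mem_iUnion]
    exact ⟨α, hα, φ ⟨y, hy⟩, n, x, φ, ⟨y, hy⟩, hφ, rfl, rfl⟩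
  · left
    exact H.finiteRange n x y hy

/-- The eigenvalues of all members of the sequence lie in one bounded interval. -/
theorem OperatorSeq.exists_eigenvalues_bound (H : OperatorSeq G) :
    ∃ M : ℝ, ∀ n i, |(H.isHermitian n).eigenvalues i| ≤ M := by
  classical
  obtain ⟨C, hC⟩ := H.finite_values.isBounded.exists_norm_le
  have hC' : ∀ n x y, |H.kernel n x y| ≤ C := fun n x y => hC _ ⟨n, x, y, rfl⟩
  -- A row has at most $(d+1)^R$ nonzero entries, each of absolute value at most `C`.
  refine ⟨((d : ℝ) + 1) ^ H.range * C, fun n i => abs_eigenvalue_le (fun x => ?_)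
    (eigenvectorBasis_ofLp_ne_zero (H.isHermitian n) i)
    ((H.isHermitian n).mulVec_eigenvectorBasis i)⟩
  have hC0 : 0 ≤ C := (abs_nonneg _).trans (hC' n x x)
  calc ∑ y, |H.matrix n x y|
      ≤ ∑ y, if y ∈ ball (G.graph n) H.range x then C else 0 := by
        refine Finset.sum_le_sum fun y _ => ?_
        split_ifs with hy
        · exact hC' n x y
        · simp [OperatorSeq.matrix, H.finiteRange n x y hy]
    _ = (ball (G.graph n) H.range x).ncard * C := by
        rw [← Finset.sum_filter, Finset.sum_const, nsmul_eq_mul, ← Set.ncard_coe_finset]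
        simp
    _ ≤ _ := by
        refine mul_le_mul_of_nonneg_right ?_ hC0
        exact_mod_cast ncard_ball_le (G.degree_le n) H.range x

theorem OperatorSeq.counting_eq (H : OperatorSeq G) (n : ℕ) (t : ℝ) :
    H.counting n t = ((Finset.univ.filter fun i => (H.isHermitian n).eigenvalues i ≤ t).card : ℝ) /
      Fintype.card (G.V n) := by
  rw [OperatorSeq.counting, ← Set.ncard_coe_finset]
  simp

end Cutting

/-! ### Counting vertices near deleted edges -/

section Edges

variable {V : Type*} {G : SimpleGraph V} {d : ℕ}

/-- Handshake lemma, with the factor 1/2 given away. It converts the edge proportion of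
hyperfiniteness into the vertex proportion that normalizes the counting functions. -/
theorem ncard_edgeSet_le [Finite V] (hd : ∀ x, (G.neighborSet x).ncard ≤ d) :
    G.edgeSet.ncard ≤ d * Nat.card V := by
  classical
  have := Fintype.ofFinite V
  have h := G.sum_degrees_eq_twice_card_edges
  have h1 : ∑ v, G.degree v ≤ ∑ _v : V, d := by
    refine Finset.sum_le_sum fun v _ => ?_
    rw [← G.card_neighborSet_eq_degree, ← Nat.card_eq_fintype_card, Nat.card_coe_set_eq]
    exact hd v
  rw [Finset.sum_const, Finset.card_univ, smul_eq_mul] at h1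
  rw [← G.coe_edgeFinset, Set.ncard_coe_finset, Nat.card_eq_fintype_card, mul_comm]
  omega

/-- A point of the `r`-ball around `y` that is cut off from `y` by deletion of the edges in `S` is
separated by an edge of `S` that meets the `r`-ball. -/
theorem exists_mem_of_not_reachable {S : Set (Sym2 V)} {r : ℕ} {x y : V} (hx : x ∈ ball G r y)
    (h : ¬ (G.deleteEdges S).Reachable y x) : ∃ e ∈ S, ∃ z ∈ e, y ∈ ball G r z := by
  induction r generalizing x with
  | zero =>
    rw [mem_ball_zero.1 hx] at h
    exact absurd (SimpleGraph.Reachable.refl _) h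
  | succ r ih =>
    obtain ⟨w, hw, hwx⟩ := mem_ball_succ hx
    -- If the predecessor `w` of `x` is still joined to `y`, the edge `wx` must have been deleted;
    -- otherwise induction applies to `w`.
    by_cases hr : (G.deleteEdges S).Reachable y w
    · rcases hwx with rfl | hadj
      · exact absurd hr h
      · refine ⟨s(w, x), ?_, w, Sym2.mem_mk_left _ _,
          mem_ball_comm.1 (mem_ball_succ_of hw (Or.inl rfl))⟩
        by_contra hS
        refine h (hr.trans (SimpleGraph.Adj.reachable ?_))
        rw [SimpleGraph.deleteEdges_adj]
        exact ⟨hadj, hS⟩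
    · obtain ⟨e, he, z, hz, hyz⟩ := ih hw hr
      exact ⟨e, he, z, hz, mem_ball_comm.1 (mem_ball_succ_of (mem_ball_comm.1 hyz) (Or.inl rfl))⟩

/-- Each edge contributes the balls around its at most two endpoints. With `r` the hopping range,
this bounds the number of columns that cutting can change. -/
theorem ncard_near_edges_le [Finite V] (hd : ∀ x, (G.neighborSet x).ncard ≤ d) (S : Set (Sym2 V))
    (r : ℕ) :
    {y | ∃ e ∈ S, ∃ z ∈ e, y ∈ ball G r z}.ncard ≤ S.ncard * (2 * (d + 1) ^ r) := by
  classical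
  have := Fintype.ofFinite V
  have hsub : {y | ∃ e ∈ S, ∃ z ∈ e, y ∈ ball G r z} ⊆
      (S.toFinset.biUnion fun e => e.toFinset.biUnion fun z => (ball G r z).toFinset : Finset V) := by
    rintro y ⟨e, he, z, hz, hy⟩
    simp only [Finset.coe_biUnion, Set.mem_iUnion]
    exact ⟨e, by simpa using he, z, by simpa using hz, by simpa using hy⟩
  refine (Set.ncard_le_ncard hsub).trans ?_
  rw [Set.ncard_coe_finset, Set.ncard_eq_toFinset_card' S]
  refine Finset.card_biUnion_le_card_mul _ _ _ fun e _ => ?_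
  refine (Finset.card_biUnion_le_card_mul _ _ ((d + 1) ^ r) fun z _ => ?_).trans
    (Nat.mul_le_mul_right _ ?_)
  · rw [← Set.ncard_eq_toFinset_card']
    exact ncard_ball_le hd r z
  · rw [Sym2.card_toFinset]
    split_ifs <;> omega

end Edges

/-! ### Hyperfiniteness yields common jump points -/

section Cutting

variable {d : ℕ} {G : GraphSeq.{u} d}

/-- For a hyperfinite sequence the eigenvalue counting functions are, up to a uniformly small error,
step functions with jumps in a common finite set. -/
theorem OperatorSeq.equiStep_counting (hyp : G.Hyperfinite) (H : OperatorSeq G) :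
    EquiStep H.counting := by
  classical
  intro ε hε
  -- Chosen so that $(\varepsilon/D)\cdot(d+1)|V|\cdot 2(d+1)^R=(\varepsilon/2)|V|$; the use of
  -- $d+1$ keeps `D` positive when $d=0$.
  set D : ℝ := 4 * ((d : ℝ) + 1) ^ H.range * (d + 1) with hD
  have hDpos : 0 < D := by positivity
  obtain ⟨K, hK⟩ := hyp (ε / D) (by positivity)
  -- The value 0 is added for the entries that cutting erases.
  obtain ⟨Λ, hΛ⟩ := exists_finset_eigenvalues.{u} (H.finite_values.insert 0) K
  refine ⟨Λ, fun n s t hst hgap => ?_⟩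
  obtain ⟨S, -, hScard, hcomp⟩ := hK n
  set G' := (G.graph n).deleteEdges S with hG'
  -- `B` erases the entries between different components of the cut graph. A column changes only if
  -- its vertex is within the hopping range of an endpoint of a deleted edge.
  let B : Matrix (G.V n) (G.V n) ℝ :=
    Matrix.of fun x y => if G'.Reachable x y then H.kernel n x y else 0
  have hB : B.IsHermitian := by
    ext x y
    simp [B, H.symm n x y, SimpleGraph.reachable_comm (u := x)]
  let bad : Set (G.V n) := {y | ∃ e ∈ S, ∃ z ∈ e, y ∈ ball (G.graph n) H.range z}
  have hAB : ∀ x y, y ∉ bad.toFinset → H.matrix n x y = B x y := by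
    intro x y hy
    by_cases hr : G'.Reachable x y
    · simp [B, hr, OperatorSeq.matrix]
    · simp only [OperatorSeq.matrix, B, Matrix.of_apply, if_neg hr]
      refine H.finiteRange n x y fun hxy => hy ?_
      rw [Set.mem_toFinset]
      exact exists_mem_of_not_reachable (mem_ball_comm.1 hxy) fun h => hr h.symm
  have hbad : (bad.toFinset.card : ℝ) ≤ ε / 2 * Fintype.card (G.V n) := by
    rw [← Set.ncard_eq_toFinset_card']
    have h1 : (bad.ncard : ℝ) ≤ S.ncard * (2 * ((d : ℝ) + 1) ^ H.range) := by
      exact_mod_cast ncard_near_edges_le (G.degree_le n) S H.range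
    have h2 : ((G.graph n).edgeSet.ncard : ℝ) ≤ d * Fintype.card (G.V n) := by
      have := ncard_edgeSet_le (G.degree_le n)
      rw [Nat.card_eq_fintype_card] at this
      exact_mod_cast this
    calc (bad.ncard : ℝ) ≤ S.ncard * (2 * ((d : ℝ) + 1) ^ H.range) := h1
      _ ≤ (ε / D * ((d + 1) * Fintype.card (G.V n))) * (2 * ((d : ℝ) + 1) ^ H.range) := by
        refine mul_le_mul_of_nonneg_right (hScard.trans ?_) (by positivity)
        refine mul_le_mul_of_nonneg_left (h2.trans ?_) (by positivity)
        exact mul_le_mul_of_nonneg_right (by linarith) (Nat.cast_nonneg _)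
      _ = _ := by
        rw [hD]
        field_simp
        ring
  have heig : ∀ i, hB.eigenvalues i ∈ Λ := by
    intro i
    -- The block to use is the component of a vertex where the eigenvector does not vanish.
    obtain ⟨x, hx⟩ := Function.ne_iff.1 (eigenvectorBasis_ofLp_ne_zero hB i)
    refine hΛ (G.V n) B _ _ (G'.connectedComponentMk x).supp (fun y z => ?_) (hcomp _) ?_
      ⟨x, rfl, hx⟩ (hB.mulVec_eigenvectorBasis i)
    · simp only [B, Matrix.of_apply]
      split_ifs
      · exact Or.inr ⟨n, y, z, rfl⟩
      · exact Or.inl rfl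
    · intro y hy z hz
      simp only [B, Matrix.of_apply]
      refine if_neg fun hr => hz ?_
      rw [SimpleGraph.ConnectedComponent.mem_supp_iff] at hy ⊢
      rw [← hy]
      exact SimpleGraph.ConnectedComponent.sound hr.symm
  -- No eigenvalue of `B` lies in $(s,t]$, so the counts of `B` agree. Comparing $H_n$ with `B` at
  -- `s` and at `t` costs $\varepsilon/2$ each.
  have hconst : (Finset.univ.filter fun i => hB.eigenvalues i ≤ t) =
      Finset.univ.filter fun i => hB.eigenvalues i ≤ s := by
    ext i
    simp only [Finset.mem_filter, Finset.mem_univ, true_and]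
    refine ⟨fun hi => ?_, fun hi => hi.trans hst⟩
    by_contra hs
    exact hgap _ (heig i) ⟨not_le.1 hs, hi⟩
  have ht := abs_card_eigenvalues_sub_le (H.isHermitian n) hB _ hAB t
  have hs := abs_card_eigenvalues_sub_le (H.isHermitian n) hB _ hAB s
  rw [hconst] at ht
  have hV : (0 : ℝ) < Fintype.card (G.V n) := by exact_mod_cast Fintype.card_pos
  rw [H.counting_eq, H.counting_eq, ← sub_div, abs_div, abs_of_pos hV, div_le_iff₀ hV]
  rw [abs_le] at *
  constructor <;> linarith

end Cutting

/-! ### Continuous approximation of the spectral projections -/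

/-- The continuous function that is `1` on `(-∞, t]`, `0` on `[t + 1/(k+1), ∞)` and affine in
between. -/
noncomputable def ramp (t : ℝ) (k : ℕ) (s : ℝ) : ℝ := max 0 (1 - ((k : ℝ) + 1) * max (s - t) 0)

theorem continuous_ramp (t : ℝ) (k : ℕ) : Continuous (ramp t k) := by
  unfold ramp
  fun_prop

theorem ramp_nonneg (t : ℝ) (k : ℕ) (s : ℝ) : 0 ≤ ramp t k s := le_max_left _ _

theorem ramp_le_one (t : ℝ) (k : ℕ) (s : ℝ) : ramp t k s ≤ 1 := by
  refine max_le zero_le_one (sub_le_self _ ?_)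
  positivity

theorem ramp_of_le {t s : ℝ} (k : ℕ) (h : s ≤ t) : ramp t k s = 1 := by
  simp [ramp, max_eq_right (sub_nonpos.2 h)]

theorem ramp_of_lt {t s : ℝ} {k : ℕ} (h : t + 1 / ((k : ℝ) + 1) < s) : ramp t k s = 0 := by
  refine max_eq_left (sub_nonpos.2 ?_)
  have hk : (0 : ℝ) < (k : ℝ) + 1 := by positivity
  have h1 : 1 / ((k : ℝ) + 1) ≤ max (s - t) 0 := le_trans (by linarith) (le_max_left _ _)
  rwa [div_le_iff₀' hk] at h1

/-- The product is nonzero only where $0<s-t<1/(k+1)$. Hence the ramps of `T` tend to zero in norm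
on multiplication by $(T-t)^+$, and so strongly on its range. -/
theorem ramp_mul_le (t : ℝ) (k : ℕ) (s : ℝ) :
    ramp t k s * max (s - t) 0 ≤ 1 / ((k : ℝ) + 1) := by
  have hk : (0 : ℝ) < (k : ℝ) + 1 := by positivity
  by_cases h : s ≤ t + 1 / ((k : ℝ) + 1)
  · refine (mul_le_of_le_one_left (le_max_right _ _) (ramp_le_one t k s)).trans ?_
    exact max_le (by linarith) (by positivity)
  · rw [ramp_of_lt (not_le.1 h), zero_mul]
    positivity

/-- The quotient is continuous, so $1-$ramp is a continuous multiple of $(s-t)^+$. In the functional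
calculus this makes every ramp act as the identity on $\ker (T-t)^+$. -/
theorem ramp_eq_sub (t : ℝ) (k : ℕ) (s : ℝ) :
    ramp t k s =
      1 - ((k : ℝ) + 1) / max 1 (((k : ℝ) + 1) * max (s - t) 0) * max (s - t) 0 := by
  unfold ramp
  rcases le_total 1 (((k : ℝ) + 1) * max (s - t) 0) with h | h
  · rw [max_eq_right h, max_eq_left (by linarith), div_mul_eq_mul_div, div_self (by linarith),
      sub_self]
  · rw [max_eq_left h, max_eq_right (by linarith), div_one]

section Projection

variable {E : Type*} [NormedAddCommGroup E] [InnerProductSpace ℂ E] [CompleteSpace E]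

theorem cfc_ramp_apply_of_mem_ker {T : E →L[ℂ] E} (hT : IsSelfAdjoint T) (t : ℝ) (k : ℕ) {w : E}
    (hw : cfc (fun s : ℝ => max (s - t) 0) T w = 0) : cfc (ramp t k) T w = w := by
  have hpos : ∀ s : ℝ, max 1 (((k : ℝ) + 1) * max (s - t) 0) ≠ 0 := fun s =>
    (lt_of_lt_of_le zero_lt_one (le_max_left _ _)).ne'
  have hc : Continuous fun s : ℝ => ((k : ℝ) + 1) / max 1 (((k : ℝ) + 1) * max (s - t) 0) :=
    continuous_const.div (by fun_prop) hpos
  have h1 : cfc (ramp t k) T = 1 - cfc (fun s : ℝ =>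
      ((k : ℝ) + 1) / max 1 (((k : ℝ) + 1) * max (s - t) 0)) T *
      cfc (fun s : ℝ => max (s - t) 0) T := by
    have hc' : Continuous fun s : ℝ =>
        ((k : ℝ) + 1) / max 1 (((k : ℝ) + 1) * max (s - t) 0) * max (s - t) 0 :=
      hc.mul (by fun_prop)
    rw [← cfc_mul _ _ T hc.continuousOn, ← cfc_one ℝ T,
      ← cfc_sub (1 : ℝ → ℝ) _ T continuousOn_const hc'.continuousOn]
    exact cfc_congr fun s _ => ramp_eq_sub t k s
  rw [h1]
  simp [hw]

/-- The operators `ramp t k T` converge strongly to the spectral projection for `(-∞, t]`. -/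
theorem tendsto_cfc_ramp {T : E →L[ℂ] E} (hT : IsSelfAdjoint T) (t : ℝ) (v : E) :
    Filter.Tendsto (fun k => cfc (ramp t k) T v) Filter.atTop
      (nhds (spectralProjection T t v)) := by
  set g : E →L[ℂ] E := cfc (fun s : ℝ => max (s - t) 0) T with hg
  have hgsa : IsSelfAdjoint g := cfc_predicate _ T
  have hnorm : ∀ k, ‖cfc (ramp t k) T‖ ≤ 1 := fun k => norm_cfc_le zero_le_one fun s _ => by
    rw [Real.norm_of_nonneg (ramp_nonneg t k s)]
    exact ramp_le_one t k s
  have hrange : ∀ k, ‖cfc (ramp t k) T * g‖ ≤ 1 / ((k : ℝ) + 1) := by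
    intro k
    rw [hg, ← cfc_mul _ _ T (continuous_ramp t k).continuousOn]
    refine norm_cfc_le (by positivity) fun s _ => ?_
    rw [Real.norm_of_nonneg (mul_nonneg (ramp_nonneg t k s) (le_max_right _ _))]
    exact ramp_mul_le t k s
  set w := spectralProjection T t v with hw
  have hwker : g w = 0 := Submodule.starProjection_apply_mem g.ker v
  have hmem : v - w ∈ g.kerᗮ := Submodule.sub_starProjection_mem_orthogonal v
  -- Since `g` is self-adjoint, $(\ker g)^\perp$ is the closure of its range. So `v - w` is
  -- approximated by some `g u`; the ramps are contractions on the error and send `g u` to 0.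
  rw [ContinuousLinearMap.orthogonal_ker, hgsa.adjoint_eq, ← SetLike.mem_coe,
    Submodule.topologicalClosure_coe, Metric.mem_closure_iff] at hmem
  rw [Metric.tendsto_nhds]
  intro ε hε
  obtain ⟨_, ⟨u, rfl⟩, hu⟩ := hmem (ε / 2) (by positivity)
  rw [dist_eq_norm] at hu
  have hlim : Filter.Tendsto (fun k : ℕ => 1 / ((k : ℝ) + 1) * ‖u‖) Filter.atTop (nhds 0) := by
    simpa using (tendsto_one_div_add_atTop_nhds_zero_nat (𝕜 := ℝ)).mul_const ‖u‖
  filter_upwards [hlim.eventually (gt_mem_nhds (by positivity : 0 < ε / 2))] with k hk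
  have hdecomp : cfc (ramp t k) T v - w =
      cfc (ramp t k) T (v - w - g u) + (cfc (ramp t k) T * g) u := by
    simp only [map_sub, mul_apply_eq_comp, cfc_ramp_apply_of_mem_ker hT t k hwker]
    abel
  rw [dist_eq_norm, hdecomp]
  have h1 : ‖cfc (ramp t k) T (v - w - g u)‖ ≤ ‖v - w - g u‖ := by
    simpa using ContinuousLinearMap.le_of_opNorm_le _ (hnorm k) (v - w - g u)
  have h2 := ContinuousLinearMap.le_of_opNorm_le _ (hrange k) u
  calc _ ≤ _ := norm_add_le _ _
    _ < ε := by
      have : ‖v - w - g u‖ < ε / 2 := hu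
      linarith

end Projection

/-! ### Convergence of the spectral measures -/

section SpectralMeasure

variable {d : ℕ} {G : GraphSeq.{u} d}

/-- The unit vector of the trace. -/
noncomputable abbrev traceVector (hG : G.WeaklyConvergent) : Hilbert hG :=
  ((toPre hG 1 : PreHilbert hG) : Hilbert hG)

/-- The trace is a vector state, so the spectral measure of $[\mathcal H]$ at this vector has the
moments $\operatorname{tr}_{\mathcal G}(\mathcal H^k)$. -/
theorem inner_traceVector (hG : G.WeaklyConvergent) (A : opAlgebra G) :
    inner ℂ (traceVector hG) (leftRep hG A (traceVector hG)) = trace A := by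
  change inner ℂ (traceVector hG) ((leftMulPre hG A).completion (traceVector hG)) = trace A
  simp [leftMulPre_apply, pre_inner_def]

/-- The average of a function over the eigenvalues of `H_n`. -/
noncomputable def OperatorSeq.average (H : OperatorSeq G) (n : ℕ) (f : ℝ → ℝ) : ℝ :=
  (∑ i, f ((H.isHermitian n).eigenvalues i)) / Fintype.card (G.V n)

/-- The integral of a continuous function with respect to the spectral measure of `[H]`. -/
noncomputable def OperatorSeq.limitAverage (H : OperatorSeq G) (hG : G.WeaklyConvergent)
    (f : ℝ → ℝ) : ℝ :=
  (inner ℂ (traceVector hG) (cfc f (H.limitOperator hG) (traceVector hG))).re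

theorem OperatorSeq.normTrace_toAlgebra_pow (H : OperatorSeq G) (k n : ℕ) :
    normTrace (H.toAlgebra ^ k) n = (H.average n (fun s => s ^ k) : ℂ) := by
  have h1 : (H.toAlgebra ^ k).1 n = ((H.matrix n) ^ k).map Complex.ofReal := by
    have : ((H.matrix n) ^ k).map Complex.ofReal = ((H.matrix n).map Complex.ofReal) ^ k :=
      map_pow (Complex.ofRealHom.mapMatrix) (H.matrix n) k
    rw [this]
    rfl
  have h2 : (((H.matrix n) ^ k).map Complex.ofReal).trace =
      (((H.matrix n) ^ k).trace : ℂ) := by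
    simp [Matrix.trace]
  rw [normTrace, h1, h2, trace_pow_eq_sum_eigenvalues (H.isHermitian n), OperatorSeq.average]
  push_cast
  rfl

/-- Benjamini–Schramm convergence enters here: the diagonal of $H_n^k$ depends only on local
patterns, so its average converges. -/
theorem OperatorSeq.tendsto_average_pow (H : OperatorSeq G) (hG : G.WeaklyConvergent) (k : ℕ) :
    Filter.Tendsto (fun n => H.average n fun s => s ^ k) Filter.atTop
      (nhds (H.limitAverage hG fun s => s ^ k)) := by
  have h := (Complex.continuous_re.tendsto _).comp (tendsto_normTrace hG (H.toAlgebra ^ k))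
  have h1 : H.limitAverage hG (fun s => s ^ k) = (trace (H.toAlgebra ^ k)).re := by
    rw [OperatorSeq.limitAverage, cfc_pow_id (R := ℝ) _ k (H.limitOperator_isSelfAdjoint hG),
      OperatorSeq.limitOperator, ← map_pow, inner_traceVector]
  rw [h1]
  refine h.congr fun n => ?_
  simp [H.normTrace_toAlgebra_pow]

theorem OperatorSeq.tendsto_average_polynomial (H : OperatorSeq G) (hG : G.WeaklyConvergent)
    (p : Polynomial ℝ) :
    Filter.Tendsto (fun n => H.average n fun s => p.eval s) Filter.atTop
      (nhds (H.limitAverage hG fun s => p.eval s)) := by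
  induction p using Polynomial.induction_on' with
  | add p q hp hq =>
    have h1 : H.limitAverage hG (fun s => (p + q).eval s) =
        H.limitAverage hG (fun s => p.eval s) + H.limitAverage hG (fun s => q.eval s) := by
      simp only [OperatorSeq.limitAverage, Polynomial.eval_add]
      rw [cfc_add _ _ _ p.continuous.continuousOn q.continuous.continuousOn]
      simp [inner_add_right]
    rw [h1]
    refine (hp.add hq).congr fun n => ?_
    simp [OperatorSeq.average, Finset.sum_add_distrib, add_div]
  | monomial k a =>
    have h1 : H.limitAverage hG (fun s => (Polynomial.monomial k a).eval s) =
        a * H.limitAverage hG (fun s => s ^ k) := by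
      simp only [OperatorSeq.limitAverage, Polynomial.eval_monomial]
      rw [cfc_const_mul a (fun s : ℝ => s ^ k) _ (by fun_prop)]
      simp [inner_smul_right_eq_smul]
    rw [h1]
    refine ((H.tendsto_average_pow hG k).const_mul a).congr fun n => ?_
    simp [OperatorSeq.average, ← Finset.mul_sum, mul_div_assoc]

theorem OperatorSeq.abs_average_sub_le (H : OperatorSeq G) (n : ℕ) {f g : ℝ → ℝ} {ε : ℝ}
    (h : ∀ i, |f ((H.isHermitian n).eigenvalues i) - g ((H.isHermitian n).eigenvalues i)| ≤ ε) :
    |H.average n f - H.average n g| ≤ ε := by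
  have hV : (0 : ℝ) < Fintype.card (G.V n) := by exact_mod_cast Fintype.card_pos
  rw [OperatorSeq.average, OperatorSeq.average, ← sub_div, ← Finset.sum_sub_distrib, abs_div,
    abs_of_pos hV, div_le_iff₀ hV]
  refine (Finset.abs_sum_le_sum_abs _ _).trans ((Finset.sum_le_sum fun i _ => h i).trans ?_)
  simp [mul_comm]

theorem OperatorSeq.abs_limitAverage_sub_le (H : OperatorSeq G) (hG : G.WeaklyConvergent)
    {f g : ℝ → ℝ} (hf : Continuous f) (hg : Continuous g) {ε : ℝ} (hε : 0 ≤ ε)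
    (h : ∀ s ∈ spectrum ℝ (H.limitOperator hG), |f s - g s| ≤ ε) :
    |H.limitAverage hG f - H.limitAverage hG g| ≤ ε * ‖traceVector hG‖ ^ 2 := by
  have h1 : H.limitAverage hG f - H.limitAverage hG g =
      (inner ℂ (traceVector hG)
        (cfc (fun s => f s - g s) (H.limitOperator hG) (traceVector hG))).re := by
    rw [cfc_sub _ _ _ hf.continuousOn hg.continuousOn]
    simp [OperatorSeq.limitAverage, inner_sub_right]
  have h2 : ‖cfc (fun s => f s - g s) (H.limitOperator hG)‖ ≤ ε := norm_cfc_le hε h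
  rw [h1]
  calc _ ≤ _ := Complex.abs_re_le_norm _
    _ ≤ _ := norm_inner_le_norm _ _
    _ ≤ ‖traceVector hG‖ * (ε * ‖traceVector hG‖) :=
      mul_le_mul_of_nonneg_left (ContinuousLinearMap.le_of_opNorm_le _ h2 _) (norm_nonneg _)
    _ = _ := by ring

/-- Weak convergence of the eigenvalue distributions to the spectral measure of `[H]`. -/
theorem OperatorSeq.tendsto_average (H : OperatorSeq G) (hG : G.WeaklyConvergent) {f : ℝ → ℝ}
    (hf : Continuous f) :
    Filter.Tendsto (fun n => H.average n f) Filter.atTop (nhds (H.limitAverage hG f)) := by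
  obtain ⟨M, hM⟩ := H.exists_eigenvalues_bound
  set T := H.limitOperator hG with hT
  -- $[-M',M']$ contains the eigenvalues of every $H_n$ and the spectrum of `T`, so one polynomial
  -- serves both sides.
  set M' := max M (‖T‖ * ‖(1 : Hilbert hG →L[ℂ] Hilbert hG)‖) with hM'
  rw [Metric.tendsto_nhds]
  intro ε hε
  -- The error on the limit side is multiplied by $\|\mathbf 1\|^2$; adding 1 makes `D` positive and
  -- the estimate strict without evaluating this norm.
  set D := ‖traceVector hG‖ ^ 2 + 1 with hD
  have hDpos : 0 < D := by positivity
  obtain ⟨p, hp⟩ := exists_polynomial_near_of_continuousOn (-M') M' f hf.continuousOn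
    (min (ε / 3) (ε / (3 * D))) (by positivity)
  have hlim := Metric.tendsto_nhds.1 (H.tendsto_average_polynomial hG p) (ε / 3) (by positivity)
  have h2 : |H.limitAverage hG (fun s => p.eval s) - H.limitAverage hG f| < ε / 3 := by
    refine lt_of_le_of_lt (H.abs_limitAverage_sub_le hG p.continuous hf
      (ε := ε / (3 * D)) (by positivity) fun s hs => ?_) ?_
    · refine (hp s ?_).le.trans (min_le_right _ _)
      have := spectrum.subset_closedBall_norm_mul (𝕜 := ℝ) T hs
      rw [mem_closedBall_zero_iff, Real.norm_eq_abs] at this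
      exact abs_le.1 (this.trans (le_max_right _ _))
    · have : ε / (3 * D) * D = ε / 3 := by field_simp
      rw [← this]
      exact mul_lt_mul_of_pos_left (by rw [hD]; linarith) (by positivity)
  filter_upwards [hlim] with n hn
  have h1 : |H.average n (fun s => p.eval s) - H.average n f| ≤ ε / 3 :=
    H.abs_average_sub_le n fun i =>
      (hp _ (abs_le.1 ((hM n i).trans (le_max_left _ _)))).le.trans (min_le_left _ _)
  rw [Real.dist_eq] at *
  rw [abs_le] at h1
  rw [abs_lt] at *
  constructor <;> linarith

/-- The ramp lies between the indicators of $(-\infty,t]$ and $(-\infty,t+1/(k+1)]$. This bound and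
the next one form the sandwich of `EquiStep.tendsto`. -/
theorem OperatorSeq.counting_le_average_ramp (H : OperatorSeq G) (n : ℕ) (t : ℝ) (k : ℕ) :
    H.counting n t ≤ H.average n (ramp t k) := by
  rw [H.counting_eq, OperatorSeq.average]
  refine div_le_div_of_nonneg_right ?_ (Nat.cast_nonneg _)
  rw [← Finset.sum_boole]
  refine Finset.sum_le_sum fun i _ => ?_
  split_ifs with h
  · exact (ramp_of_le k h).ge
  · exact ramp_nonneg _ _ _

theorem OperatorSeq.average_ramp_le_counting (H : OperatorSeq G) (n : ℕ) (t : ℝ) (k : ℕ) :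
    H.average n (ramp t k) ≤ H.counting n (t + 1 / ((k : ℝ) + 1)) := by
  rw [H.counting_eq, OperatorSeq.average]
  refine div_le_div_of_nonneg_right ?_ (Nat.cast_nonneg _)
  rw [← Finset.sum_boole]
  refine Finset.sum_le_sum fun i _ => ?_
  split_ifs with h
  · exact ramp_le_one _ _ _
  · exact (ramp_of_lt (not_le.1 h)).le

theorem OperatorSeq.tendsto_limitAverage_ramp (H : OperatorSeq G) (hG : G.WeaklyConvergent)
    (t : ℝ) :
    Filter.Tendsto (fun k => H.limitAverage hG (ramp t k)) Filter.atTop (nhds (H.ids hG t)) :=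
  (Complex.continuous_re.tendsto _).comp (Filter.Tendsto.inner tendsto_const_nhds
    (tendsto_cfc_ramp (H.limitOperator_isSelfAdjoint hG) t (traceVector hG)))

end SpectralMeasure

end GraphLimit

theorem mainTheorem5 {d : ℕ} (G : GraphLimit.GraphSeq.{u} d) (hG : G.WeaklyConvergent)
    (hyp : G.Hyperfinite) (H : GraphLimit.OperatorSeq G) :
    TendstoUniformly (fun n t => H.counting n t) (fun t => H.ids hG t) Filter.atTop := by
  have hstep := H.equiStep_counting hyp
  -- The inner application gives convergence at every `t`, letting `n` and then `k` tend to infinity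
  -- in the ramp averages; the outer one makes it uniform.
  exact hstep.tendstoUniformly (hstep.tendsto H.counting_le_average_ramp
    H.average_ramp_le_counting (fun t k => H.tendsto_average hG (GraphLimit.continuous_ramp t k))
    (H.tendsto_limitAverage_ramp hG))
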